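/- **Conventions.** For a loop-free multigraph $\Gamma$ with finitely many vertices let $\mathbb Z\Gamma$ be the free abelian group on the vertices with the bilinear form $v^2=-2$ and $u\cdot v=r$ if $u\neq v$ are joined by exactly $r\ge 0$ edges. For positive integers $n,d$ put $$F^d_{2n}(\Gamma):=(\mathbb Z\Gamma+\mathbb Zh)/\ker,\qquad h^2=2n,\quad h\cdot v=d\ \text{ for every vertex } v,$$ where $\ker$ is the radical of the bilinear form. A *polarized lattice* $S\ni h$ is a non-degenerate even lattice of finite rank with positive inertia index $1$ and a distinguished vector $h$ with $h^2>0$. It is *admissible* if there is no $e\in S$ with $e^2=-2,\ e\cdot h=0$ and no $e\in S$ with $e^2=0,\ e\cdot h=2$. Given a set $\Gamma\subset\{r\in S: r^2=-2,\ r\cdot h=d\}$, an admissible lattice $S$ is *$\Gamma$-admissible* if there is no $e\in S$ with $e^2=-2$, $1\le e\cdot h<d$ and $e\cdot v<0$ for some $v\in\Gamma$; it is *$\Gamma$-geometric* if, moreover, $S$ admits a primitive isometric embedding into the $K3$-lattice $2E_8\oplus 3U$ (with $E_8$ negative definite and $U$ the hyperbolic plane). A graph $\Gamma$ is *subgeometric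 in degree $2n$ with respect to $d$* if $F^d_{2n}(\Gamma)$ is $\Gamma$-admissible and there is a subgroup $K$ of the discriminant group $F^\vee/F$, $F:=F^d_{2n}(\Gamma)$, isotropic with respect to the quadratic form $x\bmod F\mapsto x^2\bmod 2\mathbb Z$, such that the finite index extension $\{x\in F^\vee : x \bmod F\in K\}$ of $F$ is $\Gamma$-geometric. Let $\tilde A_1$ be the graph with two vertices joined by a double edge, and let $m\tilde A_1$ be the disjoint union of $m$ copies of it. **Statement.** For every odd integer $d>1$ there is an integer $N=N(d)$ such that, for every odd integer $n\ge N$, neither of the graphs $12\tilde A_1$ and $11\tilde A_1$ is subgeometric in degree $2n$ with respect to $d$. -/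

import Mathlib

/-! ### Loop-free multigraphs -/

/-- A loop-free undirected multigraph on `V`; `mult u v` is the number of edges joining `u`, `v`. -/
structure LoopFreeMultigraph (V : Type*) where
  mult : V → V → ℕ
  symm : ∀ u v, mult u v = mult v u
  loopless : ∀ v, mult v v = 0

/-- The affine Dynkin diagram `Ã₁`: two vertices joined by a double edge. -/
def affineA1 : LoopFreeMultigraph (Fin 2) where
  mult u v := if u = v then 0 else 2
  symm u v := by simp only [eq_comm]
  loopless v := by simp

/-- The disjoint union of `m` copies of a multigraph. -/
def LoopFreeMultigraph.copies {V : Type*} (m : ℕ) (Γ : LoopFreeMultigraph V) :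
    LoopFreeMultigraph (Fin m × V) where
  mult u v := if u.1 = v.1 then Γ.mult u.2 v.2 else 0
  symm u v := by simp only [eq_comm, Γ.symm u.2 v.2]
  loopless v := by simp [Γ.loopless]

/-! ### Lattices in rational quadratic spaces

A lattice is a `ℤ`-submodule `M` of a `ℚ`-vector space `E` carrying a bilinear form `B`. -/

section Lattices

variable {E : Type*} [AddCommGroup E] [Module ℚ E]

/-- `M ∋ h` is a polarized lattice: an even non-degenerate hyperbolic lattice (positive inertia
index `1`) of finite rank, with a distinguished vector `h` of positive square. -/
structure IsPolarizedLattice (B : LinearMap.BilinForm ℚ E) (M : Submodule ℤ E) (h : E) :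
    Prop where
  symm : ∀ x ∈ M, ∀ y ∈ M, B x y = B y x
  fg : M.FG
  integral : ∀ x ∈ M, ∀ y ∈ M, ∃ k : ℤ, B x y = k
  even : ∀ x ∈ M, ∃ k : ℤ, B x x = 2 * k
  nondegenerate : ∀ x ∈ M, (∀ y ∈ M, B x y = 0) → x = 0
  hyperbolic :
    sigPos (B.toQuadraticMap.restrict (Submodule.span ℚ (M : Set E))) = 1
  mem : h ∈ M
  pos : 0 < B h h

/-- The set of vectors `r ∈ M` with `r² = -2` and `r · h = d`. -/
def latticeRoots (B : LinearMap.BilinForm ℚ E) (M : Submodule ℤ E) (h : E) (d : ℕ) : Set E :=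
  {r | r ∈ M ∧ B r r = -2 ∧ B r h = d}

/-- A polarized lattice is admissible if it has neither exceptional divisors nor
`2`-isotropic vectors. -/
def IsAdmissibleLattice (B : LinearMap.BilinForm ℚ E) (M : Submodule ℤ E) (h : E) : Prop :=
  IsPolarizedLattice B M h ∧
    (¬ ∃ e ∈ M, B e e = -2 ∧ B e h = 0) ∧
    (¬ ∃ e ∈ M, B e e = 0 ∧ B e h = 2)

/-- For `S ⊆ latticeRoots B M h d` there is no `S`-inadmissible root: no vector `e ∈ M` with
`e² = -2`, `1 ≤ e · h < d` and `e · v < 0` for some `v ∈ S`. -/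
def HasNoInadmissibleRoot (B : LinearMap.BilinForm ℚ E) (M : Submodule ℤ E) (h : E) (d : ℕ)
    (S : Set E) : Prop :=
  ∀ r : ℕ, 1 ≤ r → r < d → ¬ ∃ e ∈ latticeRoots B M h r, ∃ v ∈ S, B e v < 0

/-- `M ∋ h` is `S`-admissible, where `S` is a set of roots of degree `d`. -/
def IsAdmissibleFor (B : LinearMap.BilinForm ℚ E) (M : Submodule ℤ E) (h : E) (d : ℕ)
    (S : Set E) : Prop :=
  IsAdmissibleLattice B M h ∧ S ⊆ latticeRoots B M h d ∧ HasNoInadmissibleRoot B M h d S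

/-- The Gram matrix of the `K3`-lattice `2E₈ ⊕ 3U`, with `E₈` negative definite. -/
def k3Gram : Matrix ((Fin 8 × Fin 2) ⊕ (Fin 2 × Fin 3)) ((Fin 8 × Fin 2) ⊕ (Fin 2 × Fin 3)) ℤ :=
  Matrix.fromBlocks
    (Matrix.blockDiagonal fun _ : Fin 2 => -CartanMatrix.E₈) 0
    0 (Matrix.blockDiagonal fun _ : Fin 3 => !![0, 1; 1, 0])

/-- The underlying group of the `K3`-lattice. -/
abbrev K3Lattice : Type := (Fin 8 × Fin 2) ⊕ (Fin 2 × Fin 3) → ℤ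

/-- The bilinear form of the `K3`-lattice. -/
noncomputable def k3Form : LinearMap.BilinForm ℤ K3Lattice := Matrix.toBilin' k3Gram

/-- `M` admits a primitive isometry into the `K3`-lattice: an injective isometric homomorphism
whose cokernel is torsion free. -/
def HasPrimitiveIsometryToK3 (B : LinearMap.BilinForm ℚ E) (M : Submodule ℤ E) : Prop :=
  ∃ f : M →ₗ[ℤ] K3Lattice,
    Function.Injective f ∧
    (∀ x y : M, ((k3Form (f x) (f y) : ℤ) : ℚ) = B x y) ∧
    ∀ (m : ℤ) (y : K3Lattice), m ≠ 0 → m • y ∈ LinearMap.range f → y ∈ LinearMap.range f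

/-- `M ∋ h` is geometric: admissible and primitively embeddable into the `K3`-lattice. -/
def IsGeometricLattice (B : LinearMap.BilinForm ℚ E) (M : Submodule ℤ E) (h : E) : Prop :=
  IsAdmissibleLattice B M h ∧ HasPrimitiveIsometryToK3 B M

/-- `M ∋ h` is `S`-geometric, where `S` is a set of roots of degree `d`. -/
def IsGeometricFor (B : LinearMap.BilinForm ℚ E) (M : Submodule ℤ E) (h : E) (d : ℕ)
    (S : Set E) : Prop :=
  IsGeometricLattice B M h ∧ S ⊆ latticeRoots B M h d ∧ HasNoInadmissibleRoot B M h d S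

/-- The discriminant group `M^∨ / M`, where `M^∨ = {x | x · y ∈ ℤ for all y ∈ M}`. -/
abbrev discrGroup (B : LinearMap.BilinForm ℚ E) (M : Submodule ℤ E) : Type _ :=
  B.dualSubmodule M ⧸ M.submoduleOf (B.dualSubmodule M)

/-- A subgroup of the discriminant group is isotropic if the discriminant quadratic form
`x mod M ↦ x² mod 2ℤ` vanishes on it. -/
def IsIsotropicKernel (B : LinearMap.BilinForm ℚ E) (M : Submodule ℤ E)
    (K : Submodule ℤ (discrGroup B M)) : Prop :=
  ∀ x : B.dualSubmodule M, Submodule.Quotient.mk x ∈ K → ∃ k : ℤ, B x x = 2 * k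

/-- The extension of `M` by `K`: all vectors of `M^∨` whose discriminant class lies in `K`. -/
def latticeExtension (B : LinearMap.BilinForm ℚ E) (M : Submodule ℤ E)
    (K : Submodule ℤ (discrGroup B M)) : Submodule ℤ E :=
  (K.comap (M.submoduleOf (B.dualSubmodule M)).mkQ).map (B.dualSubmodule M).subtype

end Lattices

/-! ### The polarized lattice of a graph -/

namespace LoopFreeMultigraph

variable {V : Type*} [Fintype V] [DecidableEq V] (Γ : LoopFreeMultigraph V)

/-- The Gram matrix of `ℤΓ + ℤh`; the basis vector `h` has index `none`. Here `h² = 2n`,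
`h · v = d`, `v² = -2`, and `u · v` is the multiplicity of the edge `uv`. -/
def gram (n d : ℕ) : Matrix (Option V) (Option V) ℚ
  | none, none => 2 * n
  | none, some _ => d
  | some _, none => d
  | some u, some v => if u = v then -2 else Γ.mult u v

/-- The bilinear form on `ℚΓ + ℚh`. -/
noncomputable def preForm (n d : ℕ) : LinearMap.BilinForm ℚ (Option V → ℚ) :=
  Matrix.toBilin' (Γ.gram n d)

theorem preForm_isSymm (n d : ℕ) : (Γ.preForm n d).IsSymm := by
  rw [preForm]
  refine ⟨fun x y => ?_⟩
  have hG : (Γ.gram n d).transpose = Γ.gram n d := by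
    ext i j
    rcases i with _ | u <;> rcases j with _ | v
    · rfl
    · rfl
    · rfl
    · simp only [gram, Matrix.transpose_apply, Γ.symm v u, eq_comm]
  rw [Matrix.toBilin'_apply', Matrix.toBilin'_apply', Matrix.dotProduct_mulVec,
    ← Matrix.mulVec_transpose, hG, dotProduct_comm]

/-- The rational quadratic space `(ℚΓ + ℚh) / ker`. -/
abbrev FanoSpace (n d : ℕ) : Type _ :=
  (Option V → ℚ) ⧸ LinearMap.ker (Γ.preForm n d)

/-- The form induced on `(ℚΓ + ℚh) / ker`. -/
noncomputable def fanoForm (n d : ℕ) : LinearMap.BilinForm ℚ (Γ.FanoSpace n d) :=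
  LinearMap.IsRefl.liftQ₂ (Γ.preForm n d) (LinearMap.ker (Γ.preForm n d))
    (Γ.preForm_isSymm n d).isRefl le_rfl

/-- The class in `(ℚΓ + ℚh) / ker` of a vertex (`some v`) or of the polarization (`none`). -/
noncomputable def fanoVec (n d : ℕ) (i : Option V) : Γ.FanoSpace n d :=
  Submodule.Quotient.mk (Pi.single i 1)

/-- The lattice `(ℤΓ + ℤh) / ker`, as the image of `ℤΓ + ℤh` in `(ℚΓ + ℚh) / ker` (an integral
vector lies in the rational radical iff it lies in the integral one). -/
noncomputable def fanoLattice (n d : ℕ) : Submodule ℤ (Γ.FanoSpace n d) :=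
  Submodule.span ℤ (Set.range (Γ.fanoVec n d))

/-- The set of (the images of) the vertices of `Γ` in its lattice. -/
noncomputable def vertexSet (n d : ℕ) : Set (Γ.FanoSpace n d) :=
  Set.range fun v : V => Γ.fanoVec n d (some v)

/-- `Γ` is admissible in degree `2n` with respect to `d`. -/
def IsAdmissible (n d : ℕ) : Prop :=
  IsAdmissibleFor (Γ.fanoForm n d) (Γ.fanoLattice n d) (Γ.fanoVec n d none) d (Γ.vertexSet n d)

/-- `Γ` is subgeometric in degree `2n` with respect to `d`: it is admissible, and the extension of
its lattice by some isotropic subgroup of the discriminant group is `Γ`-geometric. -/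
def IsSubgeometric (n d : ℕ) : Prop :=
  Γ.IsAdmissible n d ∧
    ∃ K : Submodule ℤ (discrGroup (Γ.fanoForm n d) (Γ.fanoLattice n d)),
      IsIsotropicKernel (Γ.fanoForm n d) (Γ.fanoLattice n d) K ∧
      IsGeometricFor (Γ.fanoForm n d)
        (latticeExtension (Γ.fanoForm n d) (Γ.fanoLattice n d) K)
        (Γ.fanoVec n d none) d (Γ.vertexSet n d)

end LoopFreeMultigraph

/-! ### The `K3`-lattice is even and unimodular -/

/-! All fibers have the same class k modulo the radical. So a subgeometric m Ã₁ gives a primitive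
sublattice S of the K3-lattice L, of rank m + 2, rationally spanned by h, k and one vertex a_i of
each fiber (`exists_isFiberConfig`). For m = 12, 11 and n, d odd, the discriminant of S is
incompatible with the unimodularity of L.

The part of S orthogonal to k is governed by a binary code of length m: its elements are
half-integral combinations of k and the a_i, and a word records which a_i occur with a half-odd
coefficient. Evenness of L makes weights divisible by 4, and weight 4 would produce a forbidden root
(`IsWord.weight`). Modulo 2 the vectors k, a_i span a totally isotropic subspace of a nondegenerate
space of dimension 22, hence of dimension at most 11, so the code has dimension at least m - 10
(`finrank_ker_combMod`, `isWord_of_mem_ker`). Up to a permutation it is therefore {0, I, J, I + J}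
with three words of weight 8 if m = 12, and {0, K} with K of weight 8 if m = 11. As the all-one word
is absent, S pairs evenly with k, and S is known up to the multiples of k in the half-integral
vectors (the parameters r, s).

This allows 20 - m vectors y_i of S, as many as the rank of the orthogonal complement of S, with y_i
/ 8 in the dual of S. By unimodularity y_i / 8 is induced by some l_i in L, and τ_i = 8 l_i - y_i is
orthogonal to S with Gram matrix 64 e - (y_i · y_j), where e = (l_i · l_j) is symmetric with even
diagonal. Together with a basis of S over ℚ, the τ_i are 22 vectors of L, so their Gram determinant
is plus or minus a square (`exists_det_eq_sq`). After removing even powers of 2 and d², the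
resulting integer is ≡ 5 (m = 12) or 3 (m = 11) modulo 8, whatever e is. Neither is plus or minus a
square modulo 8. -/

theorem k3Gram_transpose : k3Gram.transpose = k3Gram := by
  rw [k3Gram, Matrix.fromBlocks_transpose, Matrix.blockDiagonal_transpose,
    Matrix.blockDiagonal_transpose]
  congr 2
  · funext i
    rw [Matrix.transpose_neg, CartanMatrix.E₈_transpose]
  · funext i
    decide

theorem isUnit_det_k3Gram : IsUnit k3Gram.det := by
  rw [k3Gram, Matrix.det_fromBlocks_zero₂₁, Matrix.det_blockDiagonal, Matrix.det_blockDiagonal]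
  simp [Matrix.det_neg, CartanMatrix.E₈_det, Matrix.det_fin_two]

theorem even_k3Gram_diag (i : (Fin 8 × Fin 2) ⊕ (Fin 2 × Fin 3)) : Even (k3Gram i i) := by
  rcases i with ⟨i, j⟩ | ⟨i, j⟩
  · simp [k3Gram, Matrix.blockDiagonal_apply]
  · fin_cases i <;> simp [k3Gram, Matrix.blockDiagonal_apply]

/-- A symmetric integral matrix with even diagonal defines an even form. -/
theorem even_dotProduct_mulVec {ι : Type*} [Fintype ι] (G : Matrix ι ι ℤ)
    (hG : G.transpose = G) (hd : ∀ i, Even (G i i)) (x : ι → ℤ) :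
    Even (x ⬝ᵥ G.mulVec x) := by
  classical
  have hs : ∀ i j, G i j = G j i := fun i j => by
    conv_lhs => rw [← hG]
    rfl
  rw [← ZMod.intCast_eq_zero_iff_even]
  simp only [dotProduct, Matrix.mulVec, Finset.mul_sum, ← Finset.sum_product',
    Finset.univ_product_univ, Int.cast_sum]
  -- Off-diagonal terms cancel in pairs modulo 2 by symmetry; diagonal ones are even.
  refine Finset.sum_involution (fun p _ => p.swap) ?_ ?_ (fun _ _ => Finset.mem_univ _) ?_
  · rintro ⟨i, j⟩ -
    have : x i * (G i j * x j) + x j * (G j i * x i) = 2 * (x i * (G i j * x j)) := by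
      rw [hs j i]; ring
    rw [← Int.cast_add, ZMod.intCast_eq_zero_iff_even]
    exact this ▸ even_two_mul _
  · rintro ⟨i, j⟩ - hne heq
    obtain rfl : j = i := congrArg Prod.fst heq
    refine hne ?_
    rw [ZMod.intCast_eq_zero_iff_even]
    exact ((hd j).mul_right _).mul_left _
  · rintro ⟨i, j⟩ -
    rfl

theorem k3Form_apply (x y : K3Lattice) : k3Form x y = x ⬝ᵥ k3Gram.mulVec y := by
  rw [k3Form, Matrix.toBilin'_apply']

theorem k3Form_comm (x y : K3Lattice) : k3Form x y = k3Form y x := by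
  rw [k3Form_apply, k3Form_apply, Matrix.dotProduct_mulVec, ← Matrix.mulVec_transpose,
    k3Gram_transpose, dotProduct_comm]

theorem even_k3Form_self (x : K3Lattice) : Even (k3Form x x) := by
  rw [k3Form_apply]
  exact even_dotProduct_mulVec _ k3Gram_transpose even_k3Gram_diag x

/-- Every functional on the `K3`-lattice is represented by a vector. -/
theorem exists_k3Form_eq (φ : K3Lattice →ₗ[ℤ] ℤ) : ∃ l, ∀ x, k3Form l x = φ x := by
  refine ⟨k3Gram⁻¹.mulVec fun i => φ (Pi.single i 1), fun x => ?_⟩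
  rw [k3Form_comm, k3Form_apply, Matrix.mulVec_mulVec,
    Matrix.mul_nonsing_inv _ isUnit_det_k3Gram, Matrix.one_mulVec, dotProduct]
  rw [LinearMap.pi_apply_eq_sum_univ φ x]
  refine Finset.sum_congr rfl fun i _ => ?_
  rw [smul_eq_mul]
  congr 2
  ext j
  simp [Pi.single_apply, eq_comm]

/-- A submodule with torsion free quotient. -/
def IsPrimitiveSubmodule {L : Type*} [AddCommGroup L] (S : Submodule ℤ L) : Prop :=
  ∀ (m : ℤ) (y : L), m ≠ 0 → m • y ∈ S → y ∈ S

/-- The quotient by S is finitely generated and torsion free, hence free, so S is a direct summand.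
This is what lets functionals on S extend to the whole lattice. -/
theorem exists_retraction {L : Type*} [AddCommGroup L] [Module.Finite ℤ L] (S : Submodule ℤ L)
    (hS : IsPrimitiveSubmodule S) :
    ∃ p : L →ₗ[ℤ] L, (∀ x, p x ∈ S) ∧ ∀ s ∈ S, p s = s := by
  have htf : Module.IsTorsionFree ℤ (L ⧸ S) := by
    refine Module.IsTorsionFree.of_smul_eq_zero fun m x hx => ?_
    obtain ⟨y, rfl⟩ := S.mkQ_surjective x
    by_contra! hne
    refine hne.2 ?_
    rw [Submodule.mkQ_apply, Submodule.Quotient.mk_eq_zero]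
    rw [← map_smul, Submodule.mkQ_apply, Submodule.Quotient.mk_eq_zero] at hx
    exact hS m y hne.1 hx
  have : Module.Free ℤ (L ⧸ S) := Module.free_of_finite_type_torsion_free'
  obtain ⟨g, hg⟩ := Module.projective_lifting_property S.mkQ LinearMap.id S.mkQ_surjective
  refine ⟨LinearMap.id - g ∘ₗ S.mkQ, fun x => ?_, fun s hs => ?_⟩
  · have := LinearMap.congr_fun hg (S.mkQ x)
    rw [← Submodule.Quotient.mk_eq_zero, ← Submodule.mkQ_apply]
    rw [LinearMap.comp_apply, LinearMap.id_apply] at this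
    rw [LinearMap.sub_apply, LinearMap.comp_apply, LinearMap.id_apply, map_sub, this, sub_self]
  · have : S.mkQ s = 0 := by simpa using hs
    simp [this]

/-- If `y ∈ S` pairs with `S` into `8ℤ` then the functional `y / 8` on a primitive sublattice `S`
is induced by a vector of the `K3`-lattice. -/
theorem exists_eight_mul_k3Form_eq (S : Submodule ℤ K3Lattice) (hS : IsPrimitiveSubmodule S)
    (y : K3Lattice) (hy : ∀ s ∈ S, 8 ∣ k3Form y s) :
    ∃ l, ∀ s ∈ S, 8 * k3Form l s = k3Form y s := by
  obtain ⟨p, hpS, hp⟩ := exists_retraction S hS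
  choose q hq using fun x => hy (p x) (hpS x)
  let φ : K3Lattice →ₗ[ℤ] ℤ :=
    { toFun := q
      map_add' := fun x x' => by
        have h1 := hq (x + x')
        rw [map_add, map_add, hq x, hq x'] at h1
        omega
      map_smul' := fun m x => by
        have h1 := hq (m • x)
        rw [map_smul, map_smul, hq x, smul_eq_mul] at h1
        rw [RingHom.id_apply, smul_eq_mul]
        refine mul_left_cancel₀ (show (8 : ℤ) ≠ 0 by norm_num) ?_
        linarith }
  obtain ⟨l, hl⟩ := exists_k3Form_eq φ
  refine ⟨l, fun s hs => ?_⟩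
  rw [hl s, ← (congrArg (k3Form y) (hp s hs) : _), hq s]
  rfl

/-- The Gram determinant of `22` vectors of the `K3`-lattice is a square up to sign. -/
theorem exists_det_gram_eq {κ : Type*} [Fintype κ] [DecidableEq κ] (hκ : Fintype.card κ = 22)
    (x : κ → K3Lattice) :
    ∃ t : ℤ, (Matrix.of fun i j => k3Form (x i) (x j)).det = t ^ 2 ∨
      (Matrix.of fun i j => k3Form (x i) (x j)).det = -t ^ 2 := by
  let e : κ ≃ (Fin 8 × Fin 2) ⊕ (Fin 2 × Fin 3) := Fintype.equivOfCardEq (by simp [hκ])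
  let X : Matrix κ κ ℤ := Matrix.of fun i j => x i (e j)
  have hX : (Matrix.of fun i j => k3Form (x i) (x j)) =
      X * k3Gram.submatrix e e * X.transpose := by
    ext i j
    rw [Matrix.mul_assoc, Matrix.mul_apply, Matrix.of_apply, k3Form_apply, dotProduct,
      ← e.sum_comp]
    refine Finset.sum_congr rfl fun a _ => ?_
    rw [Matrix.mul_apply, Matrix.mulVec, dotProduct, ← e.sum_comp]
    rfl
  refine ⟨X.det, ?_⟩
  rw [hX, Matrix.det_mul, Matrix.det_mul, Matrix.det_transpose, Matrix.det_submatrix_equiv_self]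
  rcases Int.isUnit_iff.1 isUnit_det_k3Gram with h | h <;> rw [h]
  · left; ring
  · right; ring

/-! ### Reduction modulo `2` -/

/-- Reduction of a vector of the `K3`-lattice modulo `2`. -/
def k3Mod (x : K3Lattice) : (Fin 8 × Fin 2) ⊕ (Fin 2 × Fin 3) → ZMod 2 := fun i => (x i : ZMod 2)

theorem k3Mod_eq_zero_iff (x : K3Lattice) : k3Mod x = 0 ↔ ∃ y : K3Lattice, x = (2 : ℤ) • y := by
  constructor
  · intro h
    have h2 : ∀ i, (2 : ℤ) ∣ x i := fun i => by
      have := congrFun h i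
      simpa [k3Mod] using (ZMod.intCast_zmod_eq_zero_iff_dvd (x i) 2).1 this
    choose y hy using h2
    exact ⟨y, funext fun i => by simp [hy i]⟩
  · rintro ⟨y, rfl⟩
    funext i
    simp [k3Mod, show (2 : ZMod 2) = 0 from rfl]

/-- The form of the `K3`-lattice modulo `2`. -/
noncomputable def k3FormMod :
    LinearMap.BilinForm (ZMod 2) ((Fin 8 × Fin 2) ⊕ (Fin 2 × Fin 3) → ZMod 2) :=
  Matrix.toBilin' (k3Gram.map (Int.castRingHom (ZMod 2)))

theorem k3FormMod_k3Mod (x y : K3Lattice) :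
    k3FormMod (k3Mod x) (k3Mod y) = (k3Form x y : ZMod 2) := by
  rw [k3FormMod, Matrix.toBilin'_apply', k3Form_apply]
  simp [dotProduct, Matrix.mulVec, k3Mod]

theorem k3FormMod_nondegenerate : k3FormMod.Nondegenerate := by
  rw [k3FormMod]
  apply Matrix.Nondegenerate.toBilin'
  apply Matrix.nondegenerate_of_det_ne_zero
  have : (k3Gram.map (Int.castRingHom (ZMod 2))).det = Int.castRingHom (ZMod 2) k3Gram.det :=
    (RingHom.map_det _ _).symm
  rw [this]
  exact (isUnit_det_k3Gram.map (Int.castRingHom (ZMod 2))).ne_zero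

/-- A totally isotropic subspace of the reduction modulo `2` has dimension at most `11`. -/
theorem finrank_le_of_isotropic
    (W : Submodule (ZMod 2) ((Fin 8 × Fin 2) ⊕ (Fin 2 × Fin 3) → ZMod 2))
    (hW : ∀ x ∈ W, ∀ y ∈ W, k3FormMod x y = 0) : Module.finrank (ZMod 2) W ≤ 11 := by
  have h1 : W ≤ k3FormMod.orthogonal W := fun x hx y hy => hW y hy x hx
  have h2 := Submodule.finrank_mono h1
  have h3 := LinearMap.BilinForm.finrank_orthogonal k3FormMod_nondegenerate W
  have h4 : Module.finrank (ZMod 2) ((Fin 8 × Fin 2) ⊕ (Fin 2 × Fin 3) → ZMod 2) = 22 := by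
    simp
  omega

/-! ### Determinants modulo `8` -/

open Matrix in
/-- Splitting off a block `!![2, -1; -1, 2]` modulo `8`, up to an even perturbation. -/
theorem exists_det_fromBlocks_eq {ι : Type*} [Fintype ι] [DecidableEq ι]
    (R : Matrix ι ι (ZMod 8)) (c : ι → ZMod 8) (e : Matrix (Fin 2 ⊕ ι) (Fin 2 ⊕ ι) (ZMod 8))
    (hs : eᵀ = e) (hd : ∀ i, ∃ a, e i i = 2 * a) :
    ∃ e' : Matrix ι ι (ZMod 8), e'ᵀ = e' ∧ (∀ i, ∃ a, e' i i = 2 * a) ∧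
      (fromBlocks !![2, -1; -1, 2] 0 0 R + e * diagonal (Sum.elim (fun _ => 2) c)).det =
        3 * (R + e' * diagonal c).det := by
  -- Even diagonal entries of the perturbation keep the diagonal product ≡ 4, and the off-diagonal
  -- entry stays odd with square 1; so the block always has determinant 4 - 1 = 3.
  have hP : ∀ x y z : ZMod 8,
      (2 + 2 * (2 * x)) * (2 + 2 * (2 * y)) - (-1 + 2 * z) * (-1 + 2 * z) = 3 := by decide
  obtain ⟨x, hx⟩ := hd (Sum.inl 0)
  obtain ⟨y, hy⟩ := hd (Sum.inl 1)
  have h10 : e (Sum.inl 1) (Sum.inl 0) = e (Sum.inl 0) (Sum.inl 1) := congrFun (congrFun hs _) _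
  let P : Matrix (Fin 2) (Fin 2) (ZMod 8) := of fun i j =>
    (!![2, -1; -1, 2] : Matrix (Fin 2) (Fin 2) (ZMod 8)) i j + 2 * e (Sum.inl i) (Sum.inl j)
  have hPdet : P.det = 3 := by
    rw [det_fin_two]
    simpa [P, hx, hy, h10] using hP x y (e (Sum.inl 0) (Sum.inl 1))
  have hPu : IsUnit P.det := by
    rw [hPdet]
    exact ⟨⟨3, 3, by decide, by decide⟩, rfl⟩
  have hPs : P⁻¹ᵀ = P⁻¹ := by
    have : Pᵀ = P := by
      ext i j
      fin_cases i <;> fin_cases j <;> simp [P, h10]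
    rw [transpose_nonsing_inv, this]
  have h21 : e.toBlocks₂₁ = e.toBlocks₁₂ᵀ := by
    ext i j
    exact (congrFun (congrFun hs _) _).symm
  have h22 : e.toBlocks₂₂ᵀ = e.toBlocks₂₂ := by
    ext i j
    exact congrFun (congrFun hs _) _
  -- The correction comes from the Schur complement of the first block. The scale 2 of that block
  -- supplies the factor 2, which keeps the diagonal even, so the splitting can be iterated.
  refine ⟨e.toBlocks₂₂ - (2 : ZMod 8) • (e.toBlocks₂₁ * P⁻¹ * e.toBlocks₁₂), ?_, fun i => ?_, ?_⟩
  · rw [transpose_sub, transpose_smul, transpose_mul, transpose_mul, h21, transpose_transpose,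
      hPs, h22, Matrix.mul_assoc]
  · obtain ⟨a, ha⟩ := hd (Sum.inr i)
    refine ⟨a - (e.toBlocks₂₁ * P⁻¹ * e.toBlocks₁₂) i i, ?_⟩
    rw [Matrix.sub_apply, Matrix.smul_apply, smul_eq_mul, mul_sub, ← ha]
    rfl
  · have hM : fromBlocks !![2, -1; -1, 2] 0 0 R + e * diagonal (Sum.elim (fun _ => 2) c) =
        fromBlocks P (e.toBlocks₁₂ * diagonal c) ((2 : ZMod 8) • e.toBlocks₂₁)
          (R + e.toBlocks₂₂ * diagonal c) := by
      ext i j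
      rcases i with i | i <;> rcases j with j | j <;>
        simp [P, toBlocks₁₂, toBlocks₂₁, toBlocks₂₂, mul_comm]
    let := invertibleOfIsUnitDet P hPu
    rw [hM, det_fromBlocks₁₁, invOf_eq_nonsing_inv, hPdet]
    congr 2
    simp only [sub_mul, smul_mul_assoc, Matrix.mul_assoc, Matrix.smul_mul]
    abel

/-- The index set of `3` blocks of size `2` followed by a block indexed by `ι`. -/
abbrev BlockIndex (ι : Type*) : Type _ := Fin 2 ⊕ (Fin 2 ⊕ (Fin 2 ⊕ ι))

/-- Three blocks `!![2, -1; -1, 2]` followed by a given block. -/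
def blockGram {R ι : Type*} [Ring R] (W : Matrix ι ι R) :
    Matrix (BlockIndex ι) (BlockIndex ι) R :=
  Matrix.fromBlocks !![2, -1; -1, 2] 0 0 <| Matrix.fromBlocks !![2, -1; -1, 2] 0 0 <|
    Matrix.fromBlocks !![2, -1; -1, 2] 0 0 W

/-- Scaling factors: `2` on the three blocks of size `2`, then given ones. -/
def blockScale {R ι : Type*} [Ring R] (c : ι → R) : BlockIndex ι → R :=
  Sum.elim (fun _ => 2) <| Sum.elim (fun _ => 2) <| Sum.elim (fun _ => 2) c

open Matrix in
theorem exists_det_blockGram_eq {ι : Type*} [Fintype ι] [DecidableEq ι]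
    (W : Matrix ι ι ℤ) (c : ι → ℤ) (e : Matrix (BlockIndex ι) (BlockIndex ι) ℤ)
    (hs : eᵀ = e) (hd : ∀ i, Even (e i i)) :
    ∃ e' : Matrix ι ι (ZMod 8), e'ᵀ = e' ∧ (∀ i, ∃ a, e' i i = 2 * a) ∧
      ((blockGram W + e * diagonal (blockScale c)).det : ZMod 8) =
        3 * (W.map (Int.cast : ℤ → ZMod 8) + e' * diagonal fun i => (c i : ZMod 8)).det := by
  let f := Int.castRingHom (ZMod 8)
  obtain ⟨e₁, hs₁, hd₁, h₁⟩ := exists_det_fromBlocks_eq (blockGram W |>.toBlocks₂₂.map f)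
    (fun i => f (blockScale c (Sum.inr i))) (e.map f) (by rw [← transpose_map, hs]) (fun i => by
      obtain ⟨a, ha⟩ := hd i
      exact ⟨a, by simp [f, ha, two_mul]⟩)
  obtain ⟨e₂, hs₂, hd₂, h₂⟩ := exists_det_fromBlocks_eq
    (blockGram W |>.toBlocks₂₂.toBlocks₂₂.map f)
    (fun i => f (blockScale c (Sum.inr (Sum.inr i)))) e₁ hs₁ hd₁
  obtain ⟨e₃, hs₃, hd₃, h₃⟩ := exists_det_fromBlocks_eq (W.map f) (fun i => f (c i)) e₂ hs₂ hd₂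
  refine ⟨e₃, hs₃, hd₃, ?_⟩
  have h0 : ((blockGram W + e * diagonal (blockScale c)).det : ZMod 8) =
      ((blockGram W + e * diagonal (blockScale c)).map f).det := RingHom.map_det f _
  have e0 : (blockGram W + e * diagonal (blockScale c)).map f =
      fromBlocks !![2, -1; -1, 2] 0 0 (blockGram W |>.toBlocks₂₂.map f) + (e.map f) *
        diagonal (Sum.elim (fun _ => 2) fun i => f (blockScale c (Sum.inr i))) := by
    ext i j
    rcases i with i | i <;> rcases j with j | j <;> simp [blockGram, blockScale, f]
    fin_cases i <;> fin_cases j <;> simp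
  have e1 : (blockGram W |>.toBlocks₂₂.map f) + e₁ *
        diagonal (fun i => f (blockScale c (Sum.inr i))) =
      fromBlocks !![2, -1; -1, 2] 0 0 (blockGram W |>.toBlocks₂₂.toBlocks₂₂.map f) + e₁ *
        diagonal (Sum.elim (fun _ => 2) fun i => f (blockScale c (Sum.inr (Sum.inr i)))) := by
    ext i j
    rcases i with i | i <;> rcases j with j | j <;> simp [blockGram, blockScale, f]
    fin_cases i <;> fin_cases j <;> simp
  have e2 : (blockGram W |>.toBlocks₂₂.toBlocks₂₂.map f) + e₂ *
        diagonal (fun i => f (blockScale c (Sum.inr (Sum.inr i)))) =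
      fromBlocks !![2, -1; -1, 2] 0 0 (W.map f) + e₂ *
        diagonal (Sum.elim (fun _ => 2) fun i => f (c i)) := by
    ext i j
    rcases i with i | i <;> rcases j with j | j <;> simp [blockGram, blockScale, f]
    fin_cases i <;> fin_cases j <;> simp
  rw [h0, e0, h₁, e1, h₂, e2, h₃, ← mul_assoc, ← mul_assoc,
    show (3 : ZMod 8) * 3 * 3 = 3 by decide]
  rfl

-- Modulo 8 the tail has determinant 6 · 4u - (odd)² = -1 whatever the perturbation, and 3 · (-1) =
-- 5.
open Matrix in
theorem det_blockGram_two (W : Matrix (Fin 2) (Fin 2) ℤ)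
    (e : Matrix (BlockIndex (Fin 2)) (BlockIndex (Fin 2)) ℤ)
    (hs : eᵀ = e) (hd : ∀ i, Even (e i i)) (h01 : W 0 1 = W 1 0) (ho : Odd (W 0 1))
    (h00 : W 0 0 = 6) (h11 : 4 ∣ W 1 1) :
    ((blockGram W + e * diagonal (blockScale fun _ => 4)).det : ZMod 8) = 5 := by
  obtain ⟨e', hs', hd', h⟩ := exists_det_blockGram_eq W (fun _ => 4) e hs hd
  obtain ⟨x, hx⟩ := hd' 0
  obtain ⟨y, hy⟩ := hd' 1
  obtain ⟨o, ho⟩ := ho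
  obtain ⟨u, hu⟩ := h11
  have h10 : e' 1 0 = e' 0 1 := congrFun (congrFun hs' 0) 1
  rw [h, det_fin_two]
  simp only [Matrix.add_apply, map_apply, mul_diagonal, h00, ← h01, hu, ho, hx, hy, h10]
  push_cast
  have key : ∀ x y z o u : ZMod 8, 3 * ((6 + 2 * x * 4) * (4 * u + 2 * y * 4) -
      (2 * o + 1 + z * 4) * (2 * o + 1 + z * 4)) = 5 := by
    intro x y z o u
    have h8 : (8 : ZMod 8) = 0 := rfl
    have ho : ∀ o : ZMod 8, (2 * o + 1) * (2 * o + 1) = 1 := by decide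
    linear_combination (-3) * ho o + 3 * (3 * u + 6 * y + x * (4 * u + 8 * y) -
      z * (2 * o + 1) - 2 * z * z) * h8 - h8
  exact key _ _ _ _ _

-- The upper 2 × 2 part of the tail has determinant ≡ 0 - (odd)² = 7. In the last column the first
-- entry vanishes modulo 8 and the second is 4b, multiplying an even minor. So the tail contributes
-- 7 · 7 = 1, for every perturbation.
open Matrix in
theorem det_blockGram_three (W : Matrix (Fin 3) (Fin 3) ℤ)
    (e : Matrix (BlockIndex (Fin 3)) (BlockIndex (Fin 3)) ℤ)
    (hs : eᵀ = e) (hd : ∀ i, Even (e i i)) (h00 : W 0 0 = 4) (h01 : W 0 1 = 1) (h10 : W 1 0 = 1)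
    (h11 : W 1 1 = 2) (h02 : 8 ∣ W 0 2) (h12 : 4 ∣ W 1 2) (h20 : 2 ∣ W 2 0)
    (h22 : (W 2 2 : ZMod 8) = 7) :
    ((blockGram W + e * diagonal (blockScale ![2, 2, 8])).det : ZMod 8) = 3 := by
  obtain ⟨e', hs', hd', h⟩ := exists_det_blockGram_eq W ![2, 2, 8] e hs hd
  obtain ⟨x, hx⟩ := hd' 0
  obtain ⟨y, hy⟩ := hd' 1
  obtain ⟨a, ha⟩ := h02
  obtain ⟨b, hb⟩ := h12
  obtain ⟨c, hc⟩ := h20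
  have h10' : e' 1 0 = e' 0 1 := congrFun (congrFun hs' 0) 1
  have h20' : e' 2 0 = e' 0 2 := congrFun (congrFun hs' 0) 2
  have h21' : e' 2 1 = e' 1 2 := congrFun (congrFun hs' 1) 2
  have h8 : (8 : ZMod 8) = 0 := rfl
  rw [h, det_fin_three]
  simp only [Matrix.add_apply, map_apply, mul_diagonal, h00, h01, h10, h11, h22, ha, hb, hc, hx, hy,
    h10', h20', h21', cons_val_zero, cons_val_one, cons_val]
  push_cast
  simp only [h8, zero_mul, mul_zero, add_zero, sub_zero]
  generalize e' 0 1 = z, e' 0 2 = p, e' 1 2 = q, (W 2 1 : ZMod 8) = w, (b : ZMod 8) = b,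
    (c : ZMod 8) = c
  have h4 : ∀ t : ZMod 8, 4 * (t * (t + 1)) = 0 := by decide
  linear_combination (18 + 21 * x + 42 * y + 42 * x * y - 6 * x * b * w - 12 * x * b * q -
    6 * b * w - 12 * b * q + 6 * b * z * c + 6 * b * z * p + 3 * b * c + 3 * b * p) * h8 -
    21 * h4 z

/-! ### Configurations of fibers in the `K3`-lattice -/

/-- The image in the `K3`-lattice of a primitive sublattice `S` rationally generated by a
polarization `h` and the vertices of `m` fibers of type `Ã₁`: `k` is the class of a fiber, and
`a i` is one of the two vertices of the `i`-th fiber. -/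
structure IsFiberConfig {m : ℕ} (n d : ℤ) (S : Submodule ℤ K3Lattice) (h k : K3Lattice)
    (a : Fin m → K3Lattice) : Prop where
  primitive : IsPrimitiveSubmodule S
  h_mem : h ∈ S
  k_mem : k ∈ S
  a_mem : ∀ i, a i ∈ S
  hh : k3Form h h = 2 * n
  hk : k3Form h k = 2 * d
  kk : k3Form k k = 0
  ka : ∀ i, k3Form k (a i) = 0
  aa : ∀ i j, k3Form (a i) (a j) = if i = j then -2 else 0
  ha : ∀ i, k3Form h (a i) = d
  gen : ∀ s ∈ S, ∃ N : ℤ, N ≠ 0 ∧ ∃ (p q : ℤ) (c : Fin m → ℤ),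
    N • s = p • h + q • k + ∑ i, c i • a i
  no_root : ∀ e ∈ S, k3Form e e = -2 → 0 ≤ k3Form e h → k3Form e h < d →
    ∀ i, 0 ≤ k3Form e (a i)

namespace IsFiberConfig

variable {m : ℕ} {n d : ℤ} {S : Submodule ℤ K3Lattice} {h k : K3Lattice} {a : Fin m → K3Lattice}

theorem comp_perm (H : IsFiberConfig n d S h k a) (σ : Equiv.Perm (Fin m)) :
    IsFiberConfig n d S h k (a ∘ σ) where
  primitive := H.primitive
  h_mem := H.h_mem
  k_mem := H.k_mem
  a_mem i := H.a_mem _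
  hh := H.hh
  hk := H.hk
  kk := H.kk
  ka i := H.ka _
  aa i j := by simp [H.aa]
  ha i := H.ha _
  gen s hs := by
    obtain ⟨N, hN, p, q, c, hc⟩ := H.gen s hs
    refine ⟨N, hN, p, q, c ∘ σ, ?_⟩
    rw [hc, ← Equiv.sum_comp σ]
    rfl
  no_root e he h1 h2 h3 i := H.no_root e he h1 h2 h3 _

theorem kh (H : IsFiberConfig n d S h k a) : k3Form k h = 2 * d := by
  rw [k3Form_comm, H.hk]

theorem ah (H : IsFiberConfig n d S h k a) (i : Fin m) : k3Form (a i) h = d := by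
  rw [k3Form_comm, H.ha]

theorem ak (H : IsFiberConfig n d S h k a) (i : Fin m) : k3Form (a i) k = 0 := by
  rw [k3Form_comm, H.ka]

theorem comb_mem (H : IsFiberConfig n d S h k a) (p q : ℤ) (c : Fin m → ℤ) :
    p • h + q • k + ∑ i, c i • a i ∈ S :=
  S.add_mem (S.add_mem (S.smul_mem _ H.h_mem) (S.smul_mem _ H.k_mem))
    (S.sum_mem fun i _ => S.smul_mem _ (H.a_mem i))

theorem form_comb (x : K3Lattice) (p q : ℤ) (c : Fin m → ℤ) :
    k3Form x (p • h + q • k + ∑ i, c i • a i) =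
      p * k3Form x h + q * k3Form x k + ∑ i, c i * k3Form x (a i) := by
  simp [-zsmul_eq_mul, map_add, map_sum]

theorem comb_h (H : IsFiberConfig n d S h k a) (p q : ℤ) (c : Fin m → ℤ) :
    k3Form (p • h + q • k + ∑ i, c i • a i) h = 2 * n * p + 2 * d * q + d * ∑ i, c i := by
  rw [k3Form_comm, form_comb, H.hh, H.hk, Finset.mul_sum]
  simp only [H.ha, mul_comm]

theorem comb_k (H : IsFiberConfig n d S h k a) (p q : ℤ) (c : Fin m → ℤ) :
    k3Form (p • h + q • k + ∑ i, c i • a i) k = 2 * d * p := by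
  rw [k3Form_comm, form_comb, H.kh, H.kk]
  simp only [H.ka, mul_zero, Finset.sum_const_zero]
  ring

theorem comb_a (H : IsFiberConfig n d S h k a) (p q : ℤ) (c : Fin m → ℤ) (j : Fin m) :
    k3Form (p • h + q • k + ∑ i, c i • a i) (a j) = d * p - 2 * c j := by
  rw [k3Form_comm, form_comb, H.ah, H.ak]
  simp only [H.aa, mul_ite, mul_zero, Finset.sum_ite_eq, Finset.mem_univ, if_true]
  ring

theorem comb_comb (H : IsFiberConfig n d S h k a) (p q : ℤ) (c : Fin m → ℤ)
    (p' q' : ℤ) (c' : Fin m → ℤ) :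
    k3Form (p • h + q • k + ∑ i, c i • a i) (p' • h + q' • k + ∑ i, c' i • a i) =
      2 * n * p * p' + 2 * d * (p * q' + q * p') + d * (p * ∑ i, c' i + p' * ∑ i, c i) -
        2 * ∑ i, c i * c' i := by
  rw [form_comb, H.comb_h, H.comb_k]
  simp only [H.comb_a, mul_sub, Finset.sum_sub_distrib]
  have e1 : ∑ i, c' i * (d * p) = (∑ i, c' i) * (d * p) := (Finset.sum_mul _ _ _).symm
  have e2 : ∑ i, c' i * (2 * c i) = 2 * ∑ i, c i * c' i := by
    rw [Finset.mul_sum]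
    exact Finset.sum_congr rfl fun i _ => by ring
  rw [e1, e2]
  ring

/-- The class of a fiber is primitive. -/
theorem exists_eq_smul_k (H : IsFiberConfig n d S h k a) (hm : 0 < m) (hd : 0 < d)
    {x : K3Lattice} (hx : x ∈ S) {N q : ℤ} (hN : N ≠ 0) (hNx : N • x = q • k) :
    ∃ j : ℤ, x = j • k := by
  have hxk : k3Form x k = 0 := by
    have := congrArg (fun z => k3Form z k) hNx
    simpa [-zsmul_eq_mul, H.kk, hN] using this
  have hxx : k3Form x x = 0 := by
    have := congrArg (fun z => k3Form x z) hNx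
    simpa [-zsmul_eq_mul, hxk, hN] using this
  have hxa : ∀ i, k3Form x (a i) = 0 := fun i => by
    have := congrArg (fun z => k3Form z (a i)) hNx
    simpa [-zsmul_eq_mul, H.ka, hN] using this
  have hxh : N * k3Form x h = q * (2 * d) := by
    have := congrArg (fun z => k3Form z h) hNx
    simpa [-zsmul_eq_mul, H.kh] using this
  have hδ : (2 * d) • x = k3Form x h • k := by
    refine smul_right_injective K3Lattice hN ?_
    change N • (2 * d) • x = N • k3Form x h • k
    rw [smul_comm, hNx, smul_smul, smul_smul, hxh, mul_comm]
  have hd2 : 0 < 2 * d := by omega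
  obtain ⟨j, r, hr0, hr1, hjr⟩ : ∃ j r : ℤ, 0 ≤ r ∧ r < 2 * d ∧ k3Form x h = 2 * d * j + r :=
    ⟨_, _, Int.emod_nonneg _ hd2.ne', Int.emod_lt_of_pos _ hd2,
      (Int.mul_ediv_add_emod _ _).symm⟩
  rcases hr0.eq_or_lt with rfl | hr0
  · refine ⟨j, smul_right_injective K3Lattice hd2.ne' ?_⟩
    change (2 * d) • x = (2 * d) • j • k
    rw [hδ, hjr, add_zero, smul_smul]
  · exfalso
    have hi := H.aa ⟨0, hm⟩ ⟨0, hm⟩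
    rw [if_pos rfl] at hi
    -- The isotropic vector x - j k has degree r strictly between 0 and 2d and is orthogonal to all
    -- vertices. Subtracting it, or k minus it when r > d, from a vertex a gives a root of degree d
    -- - r or r - d, in [0, d), that meets a in -2.
    rcases le_or_gt r d with hrd | hrd
    · have := H.no_root (a ⟨0, hm⟩ - (x - j • k))
        (S.sub_mem (H.a_mem _) (S.sub_mem hx (S.smul_mem _ H.k_mem)))
        (by simp [-zsmul_eq_mul, k3Form_comm (a _) x, hxk, k3Form_comm k x, hxa, hxx, H.kk, H.ka, H.ak, hi])
        (by simp [-zsmul_eq_mul, H.ah, H.kh, hjr]; linarith) (by simp [-zsmul_eq_mul, H.ah, H.kh, hjr]; linarith) ⟨0, hm⟩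
      simp [-zsmul_eq_mul, hi, hxa, H.ka] at this
    · have := H.no_root (a ⟨0, hm⟩ - ((j + 1) • k - x))
        (S.sub_mem (H.a_mem _) (S.sub_mem (S.smul_mem _ H.k_mem) hx))
        (by simp [-zsmul_eq_mul, k3Form_comm (a _) x, hxk, k3Form_comm k x, hxa, hxx, H.kk, H.ka, H.ak, hi])
        (by simp [-zsmul_eq_mul, H.ah, H.kh, hjr]; linarith) (by simp [-zsmul_eq_mul, H.ah, H.kh, hjr]; linarith) ⟨0, hm⟩
      simp [-zsmul_eq_mul, hi, hxa, H.ka] at this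

/-- The vectors of `S` orthogonal to the fiber class. -/
theorem exists_two_smul_eq (H : IsFiberConfig n d S h k a) (hm : 0 < m) (hd : 0 < d)
    {s : K3Lattice} (hs : s ∈ S) (hsk : k3Form s k = 0) :
    ∃ q : ℤ, (2 : ℤ) • s = q • k + ∑ i, (-k3Form s (a i)) • a i := by
  obtain ⟨N, hN, p, q, c, hc⟩ := H.gen s hs
  have hp : p = 0 := by
    have := congrArg (fun z => k3Form z k) hc
    simp only [H.comb_k, map_smul, LinearMap.smul_apply, hsk, smul_zero] at this
    have h2 : 2 * d ≠ 0 := by omega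
    exact (mul_eq_zero.1 this.symm).resolve_left h2
  subst hp
  have hca : ∀ i, N * k3Form s (a i) = -2 * c i := fun i => by
    have := congrArg (fun z => k3Form z (a i)) hc
    simp only [H.comb_a, map_smul, LinearMap.smul_apply, smul_eq_mul] at this
    linarith
  -- Correcting 2s by vertices removes its pairing with every vertex; what is left is rationally a
  -- multiple of k, and then integrally so since k is primitive.
  have key : N • ((2 : ℤ) • s - ∑ i, (-k3Form s (a i)) • a i) = (2 * q) • k := by
    rw [smul_sub, smul_comm, hc, Finset.smul_sum, smul_add, smul_add, Finset.smul_sum]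
    have : ∀ i, N • (-k3Form s (a i)) • a i = (2 : ℤ) • c i • a i := fun i => by
      rw [smul_smul, smul_smul, mul_neg, hca]
      congr 1
      ring
    simp only [this, zero_smul, smul_zero, zero_add, add_sub_cancel_right, smul_smul]
  obtain ⟨j, hj⟩ := H.exists_eq_smul_k hm hd
    (S.sub_mem (S.smul_mem _ hs) (S.sum_mem fun i _ => S.smul_mem _ (H.a_mem i))) hN key
  exact ⟨j, by rw [← hj]; abel⟩

theorem exists_eq_of_even (H : IsFiberConfig n d S h k a) (hm : 0 < m) (hd : 0 < d)
    {s : K3Lattice} (hs : s ∈ S) (hsk : k3Form s k = 0) (he : ∀ i, Even (k3Form s (a i))) :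
    ∃ (q : ℤ) (c : Fin m → ℤ), s = q • k + ∑ i, c i • a i := by
  obtain ⟨q, hq⟩ := H.exists_two_smul_eq hm hd hs hsk
  choose g hg using he
  obtain ⟨j, hj⟩ := H.exists_eq_smul_k hm hd (x := s - ∑ i, (-g i) • a i) (N := 2) (q := q)
    (S.sub_mem hs (S.sum_mem fun i _ => S.smul_mem _ (H.a_mem i))) two_ne_zero (by
      rw [smul_sub, hq, Finset.smul_sum]
      have : ∀ i, (2 : ℤ) • (-g i) • a i = (-k3Form s (a i)) • a i := fun i => by
        rw [smul_smul, hg]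
        congr 1
        ring
      simp only [this, add_sub_cancel_right])
  exact ⟨j, fun i => -g i, by rw [← hj]; abel⟩

/-- The code of the configuration: the residues modulo `2` of the intersection numbers of
vectors of `S` orthogonal to the fiber class. -/
def IsWord (S : Submodule ℤ K3Lattice) (k : K3Lattice) (a : Fin m → K3Lattice)
    (ε : Fin m → ZMod 2) : Prop :=
  ∃ s ∈ S, k3Form s k = 0 ∧ ∀ i, (k3Form s (a i) : ZMod 2) = ε i

theorem IsWord.add {ε ζ : Fin m → ZMod 2} (h₁ : IsWord S k a ε) (h₂ : IsWord S k a ζ) :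
    IsWord S k a (ε + ζ) := by
  obtain ⟨s, hs, hsk, hε⟩ := h₁
  obtain ⟨t, ht, htk, hζ⟩ := h₂
  exact ⟨s + t, S.add_mem hs ht, by simp [hsk, htk], fun i => by simp [hε, hζ]⟩

/-- A codeword lifts to a half-integral combination with coefficients `0` and `1 / 2`. -/
theorem IsWord.exists_lift (H : IsFiberConfig n d S h k a) (hm : 0 < m) (hd : 0 < d)
    {ε : Fin m → ZMod 2} (hε : IsWord S k a ε) :
    ∃ w ∈ S, k3Form w k = 0 ∧ (∀ i, k3Form w (a i) = -((ε i).val : ℤ)) ∧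
      ∃ q : ℤ, (2 : ℤ) • w = q • k + ∑ i, ((ε i).val : ℤ) • a i := by
  obtain ⟨s, hs, hsk, hε⟩ := hε
  have h2 : ∀ i, ∃ g : ℤ, -k3Form s (a i) = 2 * g + ((ε i).val : ℤ) := fun i => by
    have : ((-k3Form s (a i) - ((ε i).val : ℤ) : ℤ) : ZMod 2) = 0 := by
      simp [hε, CharTwo.neg_eq]
    obtain ⟨g, hg⟩ := (ZMod.intCast_zmod_eq_zero_iff_dvd _ 2).1 this
    exact ⟨g, by push_cast at hg; linarith⟩
  choose g hg using h2
  have hsum : (0 : ℤ) • h + (0 : ℤ) • k + ∑ i, g i • a i = ∑ i, g i • a i := by simp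
  have hw : s - ∑ i, g i • a i ∈ S :=
    S.sub_mem hs (S.sum_mem fun i _ => S.smul_mem _ (H.a_mem i))
  have hwk : k3Form (s - ∑ i, g i • a i) k = 0 := by
    rw [map_sub, LinearMap.sub_apply, hsk, ← hsum, H.comb_k]
    ring
  have hwa : ∀ i, k3Form (s - ∑ i, g i • a i) (a i) = -((ε i).val : ℤ) := fun i => by
    rw [map_sub, LinearMap.sub_apply, ← hsum, H.comb_a]
    linarith [hg i]
  obtain ⟨q, hq⟩ := H.exists_two_smul_eq hm hd hw hwk
  refine ⟨_, hw, hwk, hwa, q, ?_⟩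
  simpa only [hwa, neg_neg] using hq

/-- The lift w of a word has w² = -weight / 2, which must be even. For weight 4 the lift is itself a
root, and translating it by multiples of k brings its degree into the forbidden range. -/
theorem IsWord.weight (H : IsFiberConfig n d S h k a) (hm : 0 < m) (hd : 0 < d)
    {ε : Fin m → ZMod 2} (hε : IsWord S k a ε) :
    4 ∣ ∑ i, (ε i).val ∧ ∑ i, (ε i).val ≠ 4 := by
  obtain ⟨w, hw, hwk, hwa, q, hq⟩ := hε.exists_lift H hm hd
  have hval : ∀ x : ZMod 2, (x.val : ℤ) * x.val = x.val := by decide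
  have hww : 2 * k3Form w w = -((∑ i, (ε i).val : ℕ) : ℤ) := by
    have := congrArg (fun z => k3Form w z) hq
    simp only [map_smul, map_add, map_sum, hwk, hwa, smul_eq_mul, mul_neg, hval,
      Finset.sum_neg_distrib] at this
    push_cast
    linarith
  constructor
  · obtain ⟨r, hr⟩ := even_k3Form_self w
    have : (4 : ℤ) ∣ ((∑ i, (ε i).val : ℕ) : ℤ) := ⟨-r, by linarith⟩
    exact_mod_cast this
  · intro h4
    rw [h4] at hww
    push_cast at hww
    have hww' : k3Form w w = -2 := by linarith
    have hd2 : 0 < 2 * d := by omega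
    obtain ⟨j, r, hr0, hr1, hjr⟩ : ∃ j r : ℤ, 0 ≤ r ∧ r < 2 * d ∧ k3Form w h = 2 * d * j + r :=
      ⟨_, _, Int.emod_nonneg _ hd2.ne', Int.emod_lt_of_pos _ hd2,
        (Int.mul_ediv_add_emod _ _).symm⟩
    have hle : ∀ x : ZMod 2, x.val ≤ 1 ∧ (x ≠ 0 → x.val = 1) := by decide
    obtain ⟨i₀, hi₀⟩ : ∃ i, ε i ≠ 0 := by
      by_contra! hc
      simp [hc] at h4
    obtain ⟨i₁, hi₁, hne⟩ : ∃ i, ε i ≠ 0 ∧ i ≠ i₀ := by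
      by_contra! hc
      have : ∑ i, (ε i).val ≤ ∑ i, if i = i₀ then 1 else 0 := by
        refine Finset.sum_le_sum fun i _ => ?_
        split_ifs with hi
        · exact (hle _).1
        · rw [Nat.le_zero, ZMod.val_eq_zero]
          by_contra hc'
          exact hi (hc i hc')
      simp at this
      omega
    have hw0 := hwa i₀
    have hw1 := hwa i₁
    rw [(hle _).2 hi₀, Nat.cast_one] at hw0
    rw [(hle _).2 hi₁, Nat.cast_one] at hw1
    -- The translate of degree r in [0, 2d) meets a_{i₀} in -1. If r ≥ d, subtracting another vertex
    -- a_{i₁} of the support again gives a root, now of degree r - d < d, with the same intersection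
    -- with a_{i₀}.
    rcases lt_or_ge r d with hrd | hrd
    · have := H.no_root (w - j • k) (S.sub_mem hw (S.smul_mem _ H.k_mem))
        (by simp [-zsmul_eq_mul, hww', hwk, k3Form_comm k w, H.kk])
        (by simp [-zsmul_eq_mul, H.kh, hjr]; linarith) (by simp [-zsmul_eq_mul, H.kh, hjr]; linarith) i₀
      simp [-zsmul_eq_mul, hw0, H.ka] at this
    · have := H.no_root (w - j • k - a i₁)
        (S.sub_mem (S.sub_mem hw (S.smul_mem _ H.k_mem)) (H.a_mem _))
        (by simp [-zsmul_eq_mul, hww', hwk, k3Form_comm k w, H.kk, k3Form_comm _ w, hw1, H.ka, H.ak, H.aa])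
        (by simp [-zsmul_eq_mul, H.kh, hjr, H.ah]; linarith) (by simp [-zsmul_eq_mul, H.kh, hjr, H.ah]; linarith) i₀
      simp [-zsmul_eq_mul, hw0, H.ka, H.aa, hne] at this

/-- Reduction modulo `2` of the combinations of the fiber class and the vertices. -/
noncomputable def combMod (k : K3Lattice) (a : Fin m → K3Lattice) :
    (ZMod 2 × (Fin m → ZMod 2)) →ₗ[ZMod 2] ((Fin 8 × Fin 2) ⊕ (Fin 2 × Fin 3) → ZMod 2) :=
  (LinearMap.toSpanSingleton _ _ (k3Mod k)).coprod
    (∑ i, (LinearMap.toSpanSingleton _ _ (k3Mod (a i))).comp (LinearMap.proj i))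

theorem combMod_apply (k : K3Lattice) (a : Fin m → K3Lattice) (p : ZMod 2 × (Fin m → ZMod 2)) :
    combMod k a p = p.1 • k3Mod k + ∑ i, p.2 i • k3Mod (a i) := by
  simp [combMod]

/-- The m + 1 vectors k, a_i span a totally isotropic subspace modulo 2, so at most 11 of them are
independent. -/
theorem finrank_ker_combMod (H : IsFiberConfig n d S h k a) :
    m ≤ Module.finrank (ZMod 2) (LinearMap.ker (combMod k a)) + 10 := by
  have h1 : Module.finrank (ZMod 2) (LinearMap.range (combMod k a)) ≤ 11 := by
    refine finrank_le_of_isotropic _ ?_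
    rintro _ ⟨p, rfl⟩ _ ⟨p', rfl⟩
    have haa : ∀ i j, k3FormMod (k3Mod (a i)) (k3Mod (a j)) = 0 := fun i j => by
      rw [k3FormMod_k3Mod, H.aa]
      split_ifs <;> rfl
    simp [combMod_apply, k3FormMod_k3Mod, H.kk, H.ka, H.ak, haa]
  have h2 := LinearMap.finrank_range_add_finrank_ker (combMod k a)
  have h3 : Module.finrank (ZMod 2) (ZMod 2 × (Fin m → ZMod 2)) = m + 1 := by
    simp [add_comm]
  omega

theorem k3Mod_comb (q : ℤ) (c : Fin m → ℤ) :
    k3Mod (q • k + ∑ i, c i • a i) = combMod k a (q, fun i => (c i : ZMod 2)) := by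
  rw [combMod_apply]
  funext j
  simp [k3Mod]

/-- A relation modulo 2 lifts to a combination divisible by 2 in the K3-lattice, and its half lies
in S by primitivity. No relation is lost by passing to words, since k is not divisible by 2 in S. -/
theorem isWord_of_mem_ker (H : IsFiberConfig n d S h k a) (hm : 0 < m) (hd : 0 < d)
    {p : ZMod 2 × (Fin m → ZMod 2)} (hp : combMod k a p = 0) :
    IsWord S k a p.2 ∧ (p.2 = 0 → p = 0) := by
  have hp' : p = (((p.1.val : ℤ) : ZMod 2), fun i => (((p.2 i).val : ℤ) : ZMod 2)) := by
    ext <;> simp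
  rw [hp', ← k3Mod_comb, k3Mod_eq_zero_iff] at hp
  obtain ⟨s, hs⟩ := hp
  have hcomb : ∀ (q : ℤ) (c : Fin m → ℤ),
      q • k + ∑ i, c i • a i = (0 : ℤ) • h + q • k + ∑ i, c i • a i := by simp
  have hsS : s ∈ S := by
    refine H.primitive 2 s two_ne_zero ?_
    rw [← hs, hcomb]
    exact H.comb_mem _ _ _
  constructor
  · refine ⟨s, hsS, ?_, fun i => ?_⟩
    · have := congrArg (fun z => k3Form z k) hs
      simp only [hcomb, H.comb_k, map_smul, LinearMap.smul_apply, smul_eq_mul] at this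
      linarith
    · have := congrArg (fun z => k3Form z (a i)) hs
      simp only [hcomb, H.comb_a, map_smul, LinearMap.smul_apply, smul_eq_mul] at this
      have h' : k3Form s (a i) = -((p.2 i).val : ℤ) := by linarith
      rw [h']
      simp [CharTwo.neg_eq]
  · intro h0
    have hs' : (2 : ℤ) • s = (p.1.val : ℤ) • k := by
      rw [← hs, h0]
      simp
    obtain ⟨j, hj⟩ := H.exists_eq_smul_k hm hd hsS two_ne_zero hs'
    have hv : (p.1.val : ℤ) = 2 * j := by
      have := congrArg (fun z => k3Form z h) hs'
      simp only [hj, map_smul, LinearMap.smul_apply, smul_eq_mul, H.kh] at this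
      have hd2 : 2 * d ≠ 0 := by omega
      refine mul_right_cancel₀ hd2 ?_
      linarith
    have hle : ∀ x : ZMod 2, x.val ≤ 1 := by decide
    have h1 : p.1 = 0 := by
      rw [← ZMod.val_eq_zero]
      have := hle p.1
      omega
    exact Prod.ext h1 h0

end IsFiberConfig

/-! ### The codes of configurations of `12` and `11` fibers -/

namespace IsFiberConfig

variable {m : ℕ} {n d : ℤ} {S : Submodule ℤ K3Lattice} {h k : K3Lattice} {a : Fin m → K3Lattice}

theorem IsWord.comp_perm {ε : Fin m → ZMod 2} (hε : IsWord S k a ε) (σ : Equiv.Perm (Fin m)) :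
    IsWord S k (a ∘ σ) (ε ∘ σ) := by
  obtain ⟨s, hs, hsk, h⟩ := hε
  exact ⟨s, hs, hsk, fun i => h _⟩

/-- If x · k were odd, the combination (x · k) h - 2d x would be orthogonal to k and meet every
vertex in an odd number, d being odd. -/
theorem even_form_k (H : IsFiberConfig n d S h k a) (hdo : Odd d) (hone : ¬ IsWord S k a 1)
    {x : K3Lattice} (hx : x ∈ S) : Even (k3Form x k) := by
  by_contra hodd
  rw [Int.not_even_iff_odd] at hodd
  refine hone ⟨k3Form x k • h - (2 * d) • x,
    S.sub_mem (S.smul_mem _ H.h_mem) (S.smul_mem _ hx), ?_, fun i => ?_⟩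
  · simp only [map_sub, map_smul, LinearMap.sub_apply, LinearMap.smul_apply, H.hk, smul_eq_mul]
    ring
  · simp only [map_sub, map_smul, LinearMap.sub_apply, LinearMap.smul_apply, H.ha, smul_eq_mul,
      Pi.one_apply]
    rw [ZMod.intCast_eq_one_iff_odd, mul_assoc]
    exact (hodd.mul hdo).sub_even (even_two_mul _)

/-- A criterion for `y / 8` to define an integral functional on `S`. -/
theorem eight_dvd_form (H : IsFiberConfig n d S h k a) (hm : 0 < m) (hd : 0 < d) (hdo : Odd d)
    (hone : ¬ IsWord S k a 1) {y : K3Lattice} (hyh : 8 ∣ k3Form y h) (hyk : 8 ∣ k3Form y k)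
    (hya : ∀ i, 8 ∣ k3Form y (a i))
    (hyw : ∀ ζ, IsWord S k a ζ → ∃ w ∈ S, k3Form w k = 0 ∧
      (∀ i, (k3Form w (a i) : ZMod 2) = ζ i) ∧ 8 ∣ k3Form y w) :
    ∀ s ∈ S, 8 ∣ k3Form y s := by
  intro s hs
  obtain ⟨t, ht⟩ := H.even_form_k hdo hone hs
  -- Since s · k = 2t and h · k = 2d, this combination is orthogonal to k, so the code controls it.
  -- The factor d is harmless because it is prime to 8.
  have hz : d • s - t • h ∈ S := S.sub_mem (S.smul_mem _ hs) (S.smul_mem _ H.h_mem)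
  have hzk : k3Form (d • s - t • h) k = 0 := by
    simp only [map_sub, map_smul, LinearMap.sub_apply, LinearMap.smul_apply, H.hk, ht,
      smul_eq_mul]
    ring
  obtain ⟨w, hw, hwk, hwa, hyw⟩ := hyw _ ⟨_, hz, hzk, fun i => rfl⟩
  obtain ⟨q, c, hqc⟩ := H.exists_eq_of_even hm hd (S.sub_mem hz hw)
    (by rw [map_sub, LinearMap.sub_apply, hzk, hwk, sub_zero]) (fun i => by
      rw [← ZMod.intCast_eq_zero_iff_even, map_sub, LinearMap.sub_apply, Int.cast_sub, hwa i,
        sub_self])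
  have h1 : 8 ∣ k3Form y (d • s - t • h - w) := by
    rw [hqc]
    simp only [map_add, map_sum, map_smul, smul_eq_mul]
    exact dvd_add (hyk.mul_left _) (Finset.dvd_sum fun i _ => (hya i).mul_left _)
  have h2 : d * k3Form y s = k3Form y (d • s - t • h - w) + k3Form y w + t * k3Form y h := by
    simp only [map_sub, map_smul, smul_eq_mul]
    ring
  have h3 : 8 ∣ d * k3Form y s := h2 ▸ dvd_add (dvd_add h1 hyw) (hyh.mul_left _)
  have hcop : IsCoprime (8 : ℤ) d := by
    rw [show (8 : ℤ) = 2 ^ 3 by norm_num]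
    obtain ⟨r, hr⟩ := hdo
    exact IsCoprime.pow_left ⟨-r, 1, by rw [hr]; ring⟩
  exact hcop.dvd_of_dvd_mul_left h3

theorem val_add_val_add_one_zmod_two (x : ZMod 2) : x.val + (x + 1).val = 1 := by
  revert x; decide

theorem val_le_one_zmod_two (x : ZMod 2) : x.val ≤ 1 := by
  revert x; decide

theorem eq_zero_or_one_zmod_two (x : ZMod 2) : (x = 0 ↔ x.val = 0) ∧ (x = 1 ↔ x.val = 1) := by
  revert x; decide

/-- Two functions to `ZMod 2 × ZMod 2` with fibers of equal size differ by a permutation. -/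
theorem exists_perm_comp_eq {α γ : Type*} [Fintype α] [DecidableEq α] [DecidableEq γ] (f g : α → γ)
    (hfg : ∀ c, (Finset.univ.filter fun i => f i = c).card =
      (Finset.univ.filter fun i => g i = c).card) :
    ∃ σ : Equiv.Perm α, ∀ i, f (σ i) = g i := by
  have e : ∀ c, Nonempty ({i // g i = c} ≃ {i // f i = c}) := fun c => by
    rw [← Fintype.card_eq, Fintype.card_subtype, Fintype.card_subtype, hfg]
  exact ⟨Equiv.ofFiberEquiv fun c => (e c).some, Equiv.ofFiberEquiv_map _⟩

theorem sum_comp_zmod_two {α : Type*} [Fintype α] (f : α → ZMod 2) :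
    ∑ i, (f i).val = (Finset.univ.filter fun i => f i = 1).card := by
  rw [Finset.card_filter]
  refine Finset.sum_congr rfl fun i _ => ?_
  generalize f i = x
  revert x
  decide

/-- The first basis word in length `12`. -/
def wordI : Fin 12 → ZMod 2 := ![1, 1, 1, 1, 1, 1, 1, 1, 0, 0, 0, 0]

/-- The second basis word in length `12`. -/
def wordJ : Fin 12 → ZMod 2 := ![0, 0, 0, 0, 1, 1, 1, 1, 1, 1, 1, 1]

/-- The basis word in length `11`. -/
def wordK : Fin 11 → ZMod 2 := ![1, 1, 1, 1, 1, 1, 1, 1, 0, 0, 0]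

theorem exists_perm_wordI_wordJ {a : Fin 12 → K3Lattice} (H : IsFiberConfig n d S h k a)
    (hd : 0 < d) : ∃ σ : Equiv.Perm (Fin 12),
      IsWord S k (a ∘ σ) wordI ∧ IsWord S k (a ∘ σ) wordJ := by
  have hr := H.finrank_ker_combMod
  have hr2 : 1 < Module.finrank (ZMod 2) (LinearMap.ker (combMod k a)) := by omega
  have : Nontrivial (LinearMap.ker (combMod k a)) := 
    Module.nontrivial_of_finrank_pos (R := ZMod 2) (by omega)
  obtain ⟨x, hx⟩ := exists_ne (0 : LinearMap.ker (combMod k a))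
  obtain ⟨y, hxy⟩ := exists_linearIndependent_pair_of_one_lt_finrank hr2 hx
  have hy : y ≠ 0 := hxy.ne_zero 1
  have hne : x + y ≠ 0 := fun h0 => by
    have := (LinearIndependent.pair_iff.1 hxy) 1 1 (by simpa using h0)
    simp at this
  obtain ⟨hwx, hx0⟩ := H.isWord_of_mem_ker (by norm_num) hd x.2
  obtain ⟨hwy, hy0⟩ := H.isWord_of_mem_ker (by norm_num) hd y.2
  obtain ⟨hwxy, hxy0⟩ := H.isWord_of_mem_ker (by norm_num) hd (x + y).2
  replace hx0 := mt hx0 (by simpa using hx)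
  replace hy0 := mt hy0 (by simpa using hy)
  replace hxy0 := mt hxy0 fun h0 => hne (Subtype.ext h0)
  have hw : ∀ ε : Fin 12 → ZMod 2, IsWord S k a ε → ε ≠ 0 →
      ∑ i, (ε i).val = 8 ∨ ∑ i, (ε i).val = 12 := fun ε hε hε0 => by
    obtain ⟨h1, h2⟩ := hε.weight H (by norm_num) hd
    have h3 : ∑ i, (ε i).val ≤ ∑ i : Fin 12, 1 :=
      Finset.sum_le_sum fun i _ => val_le_one_zmod_two _
    have h4 : ∑ i, (ε i).val ≠ 0 := fun h0 => by
      refine hε0 (funext fun i => ?_)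
      have := (Finset.sum_eq_zero_iff.1 h0) i (Finset.mem_univ i)
      exact (ZMod.val_eq_zero _).1 this
    simp at h3
    omega
  have h1 := hw _ hwx hx0
  have h2 := hw _ hwy hy0
  have h3 := hw _ hwxy hxy0
  let g : Fin 12 → ZMod 2 × ZMod 2 := fun i => (x.1.2 i, y.1.2 i)
  let N : ZMod 2 × ZMod 2 → ℕ := fun c => (Finset.univ.filter fun i => g i = c).card
  have hN : ∀ F : ZMod 2 × ZMod 2 → ℕ, ∑ i, F (g i) =
      N (0, 0) * F (0, 0) + N (0, 1) * F (0, 1) + (N (1, 0) * F (1, 0) + N (1, 1) * F (1, 1)) :=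
    fun F => by
    have := Finset.sum_fiberwise' Finset.univ g F
    rw [← this, Fintype.sum_prod_type]
    simp only [Finset.sum_const, smul_eq_mul]
    exact (Fin.sum_univ_two _).trans
      (congrArg₂ _ (Fin.sum_univ_two _) (Fin.sum_univ_two _))
  have e0 := hN fun _ => 1
  have e1 := hN fun c => c.1.val
  have e2 := hN fun c => c.2.val
  have e3 := hN fun c => (c.1 + c.2).val
  have v0 : (0 : ZMod 2).val = 0 := rfl
  have v1 : (1 : ZMod 2).val = 1 := rfl
  have v2 : (1 + 1 : ZMod 2).val = 0 := rfl
  have e3' : ∑ i, ((↑(x + y) : ZMod 2 × (Fin 12 → ZMod 2)).2 i).val =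
    ∑ i, (x.1.2 i + y.1.2 i).val := rfl
  rw [e3'] at h3
  simp only [g, v0, v1, v2, add_zero, zero_add, mul_zero, mul_one, Finset.sum_const,
    Finset.card_univ, Fintype.card_fin, smul_eq_mul] at e0 e1 e2 e3
  -- The weights of x, y, x + y are 8 or 12, and their sum is twice the size of the joint support,
  -- hence at most 24. So all are 8, and the pairs (0,0), (0,1), (1,0), (1,1) occur 0, 4, 4, 4
  -- times.
  obtain ⟨σ, hσ⟩ := exists_perm_comp_eq g (fun i => (wordI i, wordJ i)) (fun c => by
    change N c = _
    have hc : c = (0, 0) ∨ c = (0, 1) ∨ c = (1, 0) ∨ c = (1, 1) := by revert c; decide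
    rcases hc with rfl | rfl | rfl | rfl
    · rw [show (Finset.univ.filter fun i => (wordI i, wordJ i) = (0, 0)).card = 0 by decide]
      omega
    · rw [show (Finset.univ.filter fun i => (wordI i, wordJ i) = (0, 1)).card = 4 by decide]
      omega
    · rw [show (Finset.univ.filter fun i => (wordI i, wordJ i) = (1, 0)).card = 4 by decide]
      omega
    · rw [show (Finset.univ.filter fun i => (wordI i, wordJ i) = (1, 1)).card = 4 by decide]
      omega)
  refine ⟨σ, ?_, ?_⟩
  · rw [show wordI = x.1.2 ∘ σ from funext fun i => (congrArg Prod.fst (hσ i)).symm]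
    exact hwx.comp_perm σ
  · rw [show wordJ = y.1.2 ∘ σ from funext fun i => (congrArg Prod.snd (hσ i)).symm]
    exact hwy.comp_perm σ

theorem exists_perm_wordK {a : Fin 11 → K3Lattice} (H : IsFiberConfig n d S h k a)
    (hd : 0 < d) : ∃ σ : Equiv.Perm (Fin 11), IsWord S k (a ∘ σ) wordK := by
  have hr := H.finrank_ker_combMod
  have : Nontrivial (LinearMap.ker (combMod k a)) := 
    Module.nontrivial_of_finrank_pos (R := ZMod 2) (by omega)
  obtain ⟨x, hx⟩ := exists_ne (0 : LinearMap.ker (combMod k a))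
  obtain ⟨hwx, hx0⟩ := H.isWord_of_mem_ker (by norm_num) hd x.2
  replace hx0 := mt hx0 (by simpa using hx)
  have hw : ∑ i, (x.1.2 i).val = 8 := by
    obtain ⟨h1, h2⟩ := hwx.weight H (by norm_num) hd
    have h3 : ∑ i, (x.1.2 i).val ≤ ∑ i : Fin 11, 1 :=
      Finset.sum_le_sum fun i _ => val_le_one_zmod_two _
    have h4 : ∑ i, (x.1.2 i).val ≠ 0 := fun h0 => by
      refine hx0 (funext fun i => ?_)
      have := (Finset.sum_eq_zero_iff.1 h0) i (Finset.mem_univ i)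
      exact (ZMod.val_eq_zero _).1 this
    simp at h3
    omega
  have hc1 : (Finset.univ.filter fun i => x.1.2 i = 1).card = 8 := by
    rw [← sum_comp_zmod_two, hw]
  have hc0 : (Finset.univ.filter fun i => x.1.2 i = 0).card = 3 := by
    have := Finset.card_filter_add_card_filter_not (s := Finset.univ) fun i => x.1.2 i = 1
    have h01 : ∀ i, ¬ x.1.2 i = 1 ↔ x.1.2 i = 0 := fun i => by
      generalize x.1.2 i = t
      revert t
      decide
    simp only [h01, Finset.card_univ, Fintype.card_fin] at this
    omega
  obtain ⟨σ, hσ⟩ := exists_perm_comp_eq x.1.2 wordK (fun c => by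
    have hc : c = 0 ∨ c = 1 := by revert c; decide
    rcases hc with rfl | rfl
    · rw [hc0]
      decide
    · rw [hc1]
      decide)
  refine ⟨σ, ?_⟩
  rw [show wordK = x.1.2 ∘ σ from funext fun i => (hσ i).symm]
  exact hwx.comp_perm σ

/-- The complement of a word of weight 8 in length 12 would have the excluded weight 4. -/
theorem not_isWord_one_twelve {a : Fin 12 → K3Lattice} (H : IsFiberConfig n d S h k a)
    (hd : 0 < d) (hI : IsWord S k a wordI) : ¬ IsWord S k a 1 := fun h1 =>
  ((h1.add hI).weight H (by norm_num) hd).2 (by decide)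

theorem not_isWord_one_eleven {a : Fin 11 → K3Lattice} (H : IsFiberConfig n d S h k a)
    (hd : 0 < d) : ¬ IsWord S k a 1 := fun h1 => by
  have := (h1.weight H (by norm_num) hd).1
  revert this
  decide

/-! ### Determination of the full code from the weight condition -/

theorem sum_fin_twelve {M : Type*} [AddCommMonoid M] (f : Fin 12 → M) :
    ∑ i, f i = f 0 + f 1 + f 2 + f 3 + f 4 + f 5 + f 6 + f 7 + f 8 + f 9 + f 10 + f 11 := by
  simp only [Fin.sum_univ_castSucc, Finset.univ_eq_empty, Finset.sum_empty, zero_add]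
  rfl

theorem sum_fin_eleven {M : Type*} [AddCommMonoid M] (f : Fin 11 → M) :
    ∑ i, f i = f 0 + f 1 + f 2 + f 3 + f 4 + f 5 + f 6 + f 7 + f 8 + f 9 + f 10 := by
  simp only [Fin.sum_univ_castSucc, Finset.univ_eq_empty, Finset.sum_empty, zero_add]
  rfl

/-- Here x, y, z are the weights of a word on the three blocks of four coordinates, and primes
denote complements; the four conditions are the weight condition for the word plus 0, I, J, I + J.
-/
theorem block_weights {x x' y y' z z' : ℕ} (ex : x + x' = 4) (ey : y + y' = 4) (ez : z + z' = 4)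
    (w0 : 4 ∣ x + y + z ∧ x + y + z ≠ 4) (w1 : 4 ∣ x' + y' + z ∧ x' + y' + z ≠ 4)
    (w2 : 4 ∣ x + y' + z' ∧ x + y' + z' ≠ 4) (w3 : 4 ∣ x' + y + z' ∧ x' + y + z' ≠ 4) :
    (x = 0 ∧ y = 0 ∧ z = 0) ∨ (x = 4 ∧ y = 4 ∧ z = 0) ∨ (x = 0 ∧ y = 4 ∧ z = 4) ∨
      (x = 4 ∧ y = 0 ∧ z = 4) := by
  obtain rfl : x' = 4 - x := by omega
  obtain rfl : y' = 4 - y := by omega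
  obtain rfl : z' = 4 - z := by omega
  have hx : x < 5 := by omega
  have hy : y < 5 := by omega
  have hz : z < 5 := by omega
  have key : ∀ x y z : Fin 5, (4 ∣ x.1 + y.1 + z.1 ∧ x.1 + y.1 + z.1 ≠ 4) →
      (4 ∣ 4 - x.1 + (4 - y.1) + z.1 ∧ 4 - x.1 + (4 - y.1) + z.1 ≠ 4) →
      (4 ∣ x.1 + (4 - y.1) + (4 - z.1) ∧ x.1 + (4 - y.1) + (4 - z.1) ≠ 4) →
      (4 ∣ 4 - x.1 + y.1 + (4 - z.1) ∧ 4 - x.1 + y.1 + (4 - z.1) ≠ 4) →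
      (x.1 = 0 ∧ y.1 = 0 ∧ z.1 = 0) ∨ (x.1 = 4 ∧ y.1 = 4 ∧ z.1 = 0) ∨ (x.1 = 0 ∧ y.1 = 4 ∧ z.1 = 4) ∨
        (x.1 = 4 ∧ y.1 = 0 ∧ z.1 = 4) := by decide
  exact key ⟨x, hx⟩ ⟨y, hy⟩ ⟨z, hz⟩ w0 w1 w2 w3

theorem weights_twelve {v0 v1 v2 v3 v4 v5 v6 v7 v8 v9 v10 v11 u0 u1 u2 u3 u4 u5 u6 u7 u8
    u9 u10 u11 : ℕ} (h0 : v0 + u0 = 1) (h1 : v1 + u1 = 1) (h2 : v2 + u2 = 1) (h3 : v3 + u3 =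
    1) (h4 : v4 + u4 = 1) (h5 : v5 + u5 = 1) (h6 : v6 + u6 = 1) (h7 : v7 + u7 = 1) (h8 : v8
    + u8 = 1) (h9 : v9 + u9 = 1) (h10 : v10 + u10 = 1) (h11 : v11 + u11 = 1) (w0 : 4 ∣ v0 +
    v1 + v2 + v3 + v4 + v5 + v6 + v7 + v8 + v9 + v10 + v11 ∧ v0 + v1 + v2 + v3 + v4 + v5 +
    v6 + v7 + v8 + v9 + v10 + v11 ≠ 4) (w1 : 4 ∣ u0 + u1 + u2 + u3 + u4 + u5 + u6 + u7 + v8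
    + v9 + v10 + v11 ∧ u0 + u1 + u2 + u3 + u4 + u5 + u6 + u7 + v8 + v9 + v10 + v11 ≠ 4) (w2
    : 4 ∣ v0 + v1 + v2 + v3 + u4 + u5 + u6 + u7 + u8 + u9 + u10 + u11 ∧ v0 + v1 + v2 + v3 +
    u4 + u5 + u6 + u7 + u8 + u9 + u10 + u11 ≠ 4) (w3 : 4 ∣ u0 + u1 + u2 + u3 + v4 + v5 + v6
    + v7 + u8 + u9 + u10 + u11 ∧ u0 + u1 + u2 + u3 + v4 + v5 + v6 + v7 + u8 + u9 + u10 + u11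
    ≠ 4) : (v0 = 0 ∧ v1 = 0 ∧ v2 = 0 ∧ v3 = 0 ∧ v4 = 0 ∧ v5 = 0 ∧ v6 = 0 ∧ v7 = 0 ∧ v8 = 0 ∧
    v9 = 0 ∧ v10 = 0 ∧ v11 = 0) ∨ (v0 = 1 ∧ v1 = 1 ∧ v2 = 1 ∧ v3 = 1 ∧ v4 = 1 ∧ v5 = 1 ∧ v6
    = 1 ∧ v7 = 1 ∧ v8 = 0 ∧ v9 = 0 ∧ v10 = 0 ∧ v11 = 0) ∨ (v0 = 0 ∧ v1 = 0 ∧ v2 = 0 ∧ v3 = 0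
    ∧ v4 = 1 ∧ v5 = 1 ∧ v6 = 1 ∧ v7 = 1 ∧ v8 = 1 ∧ v9 = 1 ∧ v10 = 1 ∧ v11 = 1) ∨ (v0 = 1 ∧
    v1 = 1 ∧ v2 = 1 ∧ v3 = 1 ∧ v4 = 0 ∧ v5 = 0 ∧ v6 = 0 ∧ v7 = 0 ∧ v8 = 1 ∧ v9 = 1 ∧ v10 = 1
    ∧ v11 = 1) := by
  obtain ⟨x, hx⟩ : ∃ x, x = v0 + v1 + v2 + v3 := ⟨_, rfl⟩
  obtain ⟨x', hx'⟩ : ∃ x', x' = u0 + u1 + u2 + u3 := ⟨_, rfl⟩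
  obtain ⟨y, hy⟩ : ∃ y, y = v4 + v5 + v6 + v7 := ⟨_, rfl⟩
  obtain ⟨y', hy'⟩ : ∃ y', y' = u4 + u5 + u6 + u7 := ⟨_, rfl⟩
  obtain ⟨z, hz⟩ : ∃ z, z = v8 + v9 + v10 + v11 := ⟨_, rfl⟩
  obtain ⟨z', hz'⟩ : ∃ z', z' = u8 + u9 + u10 + u11 := ⟨_, rfl⟩
  have ex : x + x' = 4 := by clear w0 w1 w2 w3; omega
  have ey : y + y' = 4 := by clear w0 w1 w2 w3; omega
  have ez : z + z' = 4 := by clear w0 w1 w2 w3; omega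
  have f0 : v0 + v1 + v2 + v3 + v4 + v5 + v6 + v7 + v8 + v9 + v10 + v11 = x + y + z :=
      by
    rw [hx, hy, hz]; ring
  have f1 : u0 + u1 + u2 + u3 + u4 + u5 + u6 + u7 + v8 + v9 + v10 + v11 = x' + y' + z
      := by
    rw [hx', hy', hz]; ring
  have f2 : v0 + v1 + v2 + v3 + u4 + u5 + u6 + u7 + u8 + u9 + u10 + u11 = x + y' + z'
      := by
    rw [hx, hy', hz']; ring
  have f3 : u0 + u1 + u2 + u3 + v4 + v5 + v6 + v7 + u8 + u9 + u10 + u11 = x' + y + z'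
      := by
    rw [hx', hy, hz']; ring
  rw [f0] at w0
  rw [f1] at w1
  rw [f2] at w2
  rw [f3] at w3
  have hc := block_weights ex ey ez w0 w1 w2 w3
  clear w0 w1 w2 w3 f0 f1 f2 f3
  rcases hc with hc | hc | hc | hc
  · left; omega
  · right; left; omega
  · right; right; left; omega
  · right; right; right; omega

theorem weights_eleven {v0 v1 v2 v3 v4 v5 v6 v7 v8 v9 v10 u0 u1 u2 u3 u4 u5 u6 u7 u8 u9
    u10 : ℕ} (h0 : v0 + u0 = 1) (h1 : v1 + u1 = 1) (h2 : v2 + u2 = 1) (h3 : v3 + u3 = 1) (h4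
    : v4 + u4 = 1) (h5 : v5 + u5 = 1) (h6 : v6 + u6 = 1) (h7 : v7 + u7 = 1) (h8 : v8 + u8 =
    1) (h9 : v9 + u9 = 1) (h10 : v10 + u10 = 1) (w0 : 4 ∣ v0 + v1 + v2 + v3 + v4 + v5 + v6 +
    v7 + v8 + v9 + v10 ∧ v0 + v1 + v2 + v3 + v4 + v5 + v6 + v7 + v8 + v9 + v10 ≠ 4) (w1 : 4
    ∣ u0 + u1 + u2 + u3 + u4 + u5 + u6 + u7 + v8 + v9 + v10 ∧ u0 + u1 + u2 + u3 + u4 + u5 +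
    u6 + u7 + v8 + v9 + v10 ≠ 4) : (v0 = 0 ∧ v1 = 0 ∧ v2 = 0 ∧ v3 = 0 ∧ v4 = 0 ∧ v5 = 0 ∧ v6
    = 0 ∧ v7 = 0 ∧ v8 = 0 ∧ v9 = 0 ∧ v10 = 0) ∨ (v0 = 1 ∧ v1 = 1 ∧ v2 = 1 ∧ v3 = 1 ∧ v4 = 1
    ∧ v5 = 1 ∧ v6 = 1 ∧ v7 = 1 ∧ v8 = 0 ∧ v9 = 0 ∧ v10 = 0) := by
  obtain ⟨x, hx⟩ : ∃ x, x = v0 + v1 + v2 + v3 + v4 + v5 + v6 + v7 := ⟨_, rfl⟩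
  obtain ⟨x', hx'⟩ : ∃ x', x' = u0 + u1 + u2 + u3 + u4 + u5 + u6 + u7 := ⟨_, rfl⟩
  obtain ⟨y, hy⟩ : ∃ y, y = v8 + v9 + v10 := ⟨_, rfl⟩
  obtain ⟨y', hy'⟩ : ∃ y', y' = u8 + u9 + u10 := ⟨_, rfl⟩
  have ex : x + x' = 8 := by clear w0 w1; omega
  have ey : y + y' = 3 := by clear w0 w1; omega
  have f0 : v0 + v1 + v2 + v3 + v4 + v5 + v6 + v7 + v8 + v9 + v10 = x + y := by
    rw [hx, hy]; ring
  have f1 : u0 + u1 + u2 + u3 + u4 + u5 + u6 + u7 + v8 + v9 + v10 = x' + y := by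
    rw [hx', hy]; ring
  rw [f0] at w0
  rw [f1] at w1
  have hc : (x = 0 ∧ y = 0) ∨ (x = 8 ∧ y = 0) := by
    clear f0 f1 hx hx' hy hy' h0 h1 h2 h3 h4 h5 h6 h7 h8 h9 h10
    omega
  clear w0 w1 f0 f1
  rcases hc with hc | hc
  · left; omega
  · right; omega

theorem IsWord.eq_twelve {a : Fin 12 → K3Lattice} (H : IsFiberConfig n d S h k a)
    (hd : 0 < d) (hI : IsWord S k a wordI) (hJ : IsWord S k a wordJ) {ζ : Fin 12 → ZMod 2}
    (hζ : IsWord S k a ζ) : ζ = 0 ∨ ζ = wordI ∨ ζ = wordJ ∨ ζ = wordI + wordJ := by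
  have w0 := hζ.weight H (by norm_num) hd
  have w1 := (hζ.add hI).weight H (by norm_num) hd
  have w2 := (hζ.add hJ).weight H (by norm_num) hd
  have w3 := (hζ.add (hI.add hJ)).weight H (by norm_num) hd
  have h11 : (1 + 1 : ZMod 2) = 0 := rfl
  simp only [sum_fin_twelve, Pi.add_apply, wordI, wordJ, Matrix.cons_val, add_zero, zero_add,
    h11] at w0 w1 w2 w3
  have hv := fun i => val_add_val_add_one_zmod_two (ζ i)
  have hc := weights_twelve (hv 0) (hv 1) (hv 2) (hv 3) (hv 4) (hv 5)
    (hv 6) (hv 7) (hv 8) (hv 9) (hv 10) (hv 11) w0 w1 w2 w3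
  clear w0 w1 w2 w3 hv
  rcases hc with hc | hc | hc | hc
  · obtain ⟨h0, h1, h2, h3, h4, h5, h6, h7, h8, h9, h10, h11⟩ := hc
    refine Or.inl <| funext fun i => ?_
    fin_cases i
    · exact (eq_zero_or_one_zmod_two (ζ 0)).1.2 h0
    · exact (eq_zero_or_one_zmod_two (ζ 1)).1.2 h1
    · exact (eq_zero_or_one_zmod_two (ζ 2)).1.2 h2
    · exact (eq_zero_or_one_zmod_two (ζ 3)).1.2 h3
    · exact (eq_zero_or_one_zmod_two (ζ 4)).1.2 h4
    · exact (eq_zero_or_one_zmod_two (ζ 5)).1.2 h5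
    · exact (eq_zero_or_one_zmod_two (ζ 6)).1.2 h6
    · exact (eq_zero_or_one_zmod_two (ζ 7)).1.2 h7
    · exact (eq_zero_or_one_zmod_two (ζ 8)).1.2 h8
    · exact (eq_zero_or_one_zmod_two (ζ 9)).1.2 h9
    · exact (eq_zero_or_one_zmod_two (ζ 10)).1.2 h10
    · exact (eq_zero_or_one_zmod_two (ζ 11)).1.2 h11
  · obtain ⟨h0, h1, h2, h3, h4, h5, h6, h7, h8, h9, h10, h11⟩ := hc
    refine Or.inr <| Or.inl <| funext fun i => ?_
    fin_cases i
    · exact (eq_zero_or_one_zmod_two (ζ 0)).2.2 h0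
    · exact (eq_zero_or_one_zmod_two (ζ 1)).2.2 h1
    · exact (eq_zero_or_one_zmod_two (ζ 2)).2.2 h2
    · exact (eq_zero_or_one_zmod_two (ζ 3)).2.2 h3
    · exact (eq_zero_or_one_zmod_two (ζ 4)).2.2 h4
    · exact (eq_zero_or_one_zmod_two (ζ 5)).2.2 h5
    · exact (eq_zero_or_one_zmod_two (ζ 6)).2.2 h6
    · exact (eq_zero_or_one_zmod_two (ζ 7)).2.2 h7
    · exact (eq_zero_or_one_zmod_two (ζ 8)).1.2 h8
    · exact (eq_zero_or_one_zmod_two (ζ 9)).1.2 h9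
    · exact (eq_zero_or_one_zmod_two (ζ 10)).1.2 h10
    · exact (eq_zero_or_one_zmod_two (ζ 11)).1.2 h11
  · obtain ⟨h0, h1, h2, h3, h4, h5, h6, h7, h8, h9, h10, h11⟩ := hc
    refine Or.inr <| Or.inr <| Or.inl <| funext fun i => ?_
    fin_cases i
    · exact (eq_zero_or_one_zmod_two (ζ 0)).1.2 h0
    · exact (eq_zero_or_one_zmod_two (ζ 1)).1.2 h1
    · exact (eq_zero_or_one_zmod_two (ζ 2)).1.2 h2
    · exact (eq_zero_or_one_zmod_two (ζ 3)).1.2 h3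
    · exact (eq_zero_or_one_zmod_two (ζ 4)).2.2 h4
    · exact (eq_zero_or_one_zmod_two (ζ 5)).2.2 h5
    · exact (eq_zero_or_one_zmod_two (ζ 6)).2.2 h6
    · exact (eq_zero_or_one_zmod_two (ζ 7)).2.2 h7
    · exact (eq_zero_or_one_zmod_two (ζ 8)).2.2 h8
    · exact (eq_zero_or_one_zmod_two (ζ 9)).2.2 h9
    · exact (eq_zero_or_one_zmod_two (ζ 10)).2.2 h10
    · exact (eq_zero_or_one_zmod_two (ζ 11)).2.2 h11
  · obtain ⟨h0, h1, h2, h3, h4, h5, h6, h7, h8, h9, h10, h11⟩ := hc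
    refine Or.inr <| Or.inr <| Or.inr <| funext fun i => ?_
    fin_cases i
    · exact (eq_zero_or_one_zmod_two (ζ 0)).2.2 h0
    · exact (eq_zero_or_one_zmod_two (ζ 1)).2.2 h1
    · exact (eq_zero_or_one_zmod_two (ζ 2)).2.2 h2
    · exact (eq_zero_or_one_zmod_two (ζ 3)).2.2 h3
    · exact (eq_zero_or_one_zmod_two (ζ 4)).1.2 h4
    · exact (eq_zero_or_one_zmod_two (ζ 5)).1.2 h5
    · exact (eq_zero_or_one_zmod_two (ζ 6)).1.2 h6
    · exact (eq_zero_or_one_zmod_two (ζ 7)).1.2 h7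
    · exact (eq_zero_or_one_zmod_two (ζ 8)).2.2 h8
    · exact (eq_zero_or_one_zmod_two (ζ 9)).2.2 h9
    · exact (eq_zero_or_one_zmod_two (ζ 10)).2.2 h10
    · exact (eq_zero_or_one_zmod_two (ζ 11)).2.2 h11

theorem IsWord.eq_eleven {a : Fin 11 → K3Lattice} (H : IsFiberConfig n d S h k a)
    (hd : 0 < d) (hK : IsWord S k a wordK) {ζ : Fin 11 → ZMod 2}
    (hζ : IsWord S k a ζ) : ζ = 0 ∨ ζ = wordK := by
  have w0 := hζ.weight H (by norm_num) hd
  have w1 := (hζ.add hK).weight H (by norm_num) hd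
  simp only [sum_fin_eleven, Pi.add_apply, wordK, Matrix.cons_val, add_zero] at w0 w1
  have hv := fun i => val_add_val_add_one_zmod_two (ζ i)
  have hc := weights_eleven (hv 0) (hv 1) (hv 2) (hv 3) (hv 4) (hv 5)
    (hv 6) (hv 7) (hv 8) (hv 9) (hv 10) w0 w1
  clear w0 w1 hv
  rcases hc with hc | hc
  · obtain ⟨h0, h1, h2, h3, h4, h5, h6, h7, h8, h9, h10⟩ := hc
    refine Or.inl <| funext fun i => ?_
    fin_cases i
    · exact (eq_zero_or_one_zmod_two (ζ 0)).1.2 h0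
    · exact (eq_zero_or_one_zmod_two (ζ 1)).1.2 h1
    · exact (eq_zero_or_one_zmod_two (ζ 2)).1.2 h2
    · exact (eq_zero_or_one_zmod_two (ζ 3)).1.2 h3
    · exact (eq_zero_or_one_zmod_two (ζ 4)).1.2 h4
    · exact (eq_zero_or_one_zmod_two (ζ 5)).1.2 h5
    · exact (eq_zero_or_one_zmod_two (ζ 6)).1.2 h6
    · exact (eq_zero_or_one_zmod_two (ζ 7)).1.2 h7
    · exact (eq_zero_or_one_zmod_two (ζ 8)).1.2 h8
    · exact (eq_zero_or_one_zmod_two (ζ 9)).1.2 h9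
    · exact (eq_zero_or_one_zmod_two (ζ 10)).1.2 h10
  · obtain ⟨h0, h1, h2, h3, h4, h5, h6, h7, h8, h9, h10⟩ := hc
    refine Or.inr <| funext fun i => ?_
    fin_cases i
    · exact (eq_zero_or_one_zmod_two (ζ 0)).2.2 h0
    · exact (eq_zero_or_one_zmod_two (ζ 1)).2.2 h1
    · exact (eq_zero_or_one_zmod_two (ζ 2)).2.2 h2
    · exact (eq_zero_or_one_zmod_two (ζ 3)).2.2 h3
    · exact (eq_zero_or_one_zmod_two (ζ 4)).2.2 h4
    · exact (eq_zero_or_one_zmod_two (ζ 5)).2.2 h5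
    · exact (eq_zero_or_one_zmod_two (ζ 6)).2.2 h6
    · exact (eq_zero_or_one_zmod_two (ζ 7)).2.2 h7
    · exact (eq_zero_or_one_zmod_two (ζ 8)).1.2 h8
    · exact (eq_zero_or_one_zmod_two (ζ 9)).1.2 h9
    · exact (eq_zero_or_one_zmod_two (ζ 10)).1.2 h10

end IsFiberConfig

/-! ### The Gram determinant of a complement -/

namespace IsFiberConfig

variable {m : ℕ} {n d : ℤ} {S : Submodule ℤ K3Lattice} {h k : K3Lattice} {a : Fin m → K3Lattice}

open Matrix in
/-- If vectors `y i / 8` of the dual of `S` are as many as the rank of the orthogonal complement of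
`S`, then the Gram matrix of `y`, up to sign and up to `64` times an even symmetric matrix, has a
determinant that is known up to squares. -/
theorem exists_det_eq_sq (H : IsFiberConfig n d S h k a) {κ : Type*} [Fintype κ] [DecidableEq κ]
    (hκ : m + 2 + Fintype.card κ = 22) (y : κ → K3Lattice) (hyS : ∀ i, y i ∈ S)
    (hy : ∀ i, ∀ s ∈ S, 8 ∣ k3Form (y i) s) :
    ∃ e : Matrix κ κ ℤ, eᵀ = e ∧ (∀ i, Even (e i i)) ∧ ∃ t : ℤ,
      16 * d ^ 2 * 2 ^ m * (Matrix.of fun i j => 64 * e i j - k3Form (y i) (y j)).det = t ^ 2 ∨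
      16 * d ^ 2 * 2 ^ m * (Matrix.of fun i j => 64 * e i j - k3Form (y i) (y j)).det =
        -t ^ 2 := by
  choose l hl using fun i => exists_eight_mul_k3Form_eq S H.primitive (y i) (hy i)
  -- The functionals l_i and y_i / 8 agree on S, so τ_i lies in the orthogonal complement of S.
  let τ : κ → K3Lattice := fun i => (8 : ℤ) • l i - y i
  have hτS : ∀ i, ∀ s ∈ S, k3Form (τ i) s = 0 := fun i s hs => by
    simp only [τ, map_sub, map_smul, LinearMap.sub_apply, LinearMap.smul_apply, smul_eq_mul,
      hl i s hs, sub_self]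
  have hττ : ∀ i j, k3Form (τ i) (τ j) = 64 * k3Form (l i) (l j) - k3Form (y i) (y j) :=
    fun i j => by
    have h1 : k3Form (τ i) (τ j) = 8 * k3Form (τ i) (l j) := by
      conv_lhs => rw [show τ j = (8 : ℤ) • l j - y j from rfl]
      rw [map_sub, hτS i _ (hyS j), map_smul, smul_eq_mul, sub_zero]
    have h2 : k3Form (τ i) (l j) = 8 * k3Form (l i) (l j) - k3Form (y i) (l j) := by
      simp only [τ, map_sub, map_smul, LinearMap.sub_apply, LinearMap.smul_apply, smul_eq_mul]
    have h3 := hl j (y i) (hyS i)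
    rw [k3Form_comm (l j), k3Form_comm (y j)] at h3
    rw [h1, h2]
    linarith
  refine ⟨Matrix.of fun i j => k3Form (l i) (l j), ?_, fun i => even_k3Form_self _, ?_⟩
  · ext i j
    exact k3Form_comm _ _
  -- The vector 2h + d Σ a_i is orthogonal to every a_j and meets k in 4d, so the Gram matrix of v
  -- splits, with determinant -16 d² (-2)^m.
  let v : Fin 2 ⊕ Fin m → K3Lattice :=
    Sum.elim ![(2 : ℤ) • h + (0 : ℤ) • k + ∑ i, (fun _ => d) i • a i,
      (0 : ℤ) • h + (1 : ℤ) • k + ∑ i, (0 : Fin m → ℤ) i • a i] a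
  have hvS : ∀ i, v i ∈ S := by
    rintro (i | i)
    · fin_cases i
      · exact H.comb_mem _ _ _
      · exact H.comb_mem _ _ _
    · exact H.a_mem i
  have hG : (Matrix.of fun i j => k3Form (Sum.elim v τ i) (Sum.elim v τ j)) =
      fromBlocks (fromBlocks !![k3Form (v (Sum.inl 0)) (v (Sum.inl 0)), 4 * d; 4 * d, 0] 0 0
        ((-2 : ℤ) • (1 : Matrix (Fin m) (Fin m) ℤ))) 0 0
        (Matrix.of fun i j => 64 * k3Form (l i) (l j) - k3Form (y i) (y j)) := by
    ext i j
    rcases i with (i | i) | i <;> rcases j with (j | j) | j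
    · fin_cases i <;> fin_cases j
      · rfl
      · change k3Form (_ + _ + _) (_ + _ + _) = 4 * d
        rw [H.comb_comb]
        simp
        ring
      · change k3Form (_ + _ + _) (_ + _ + _) = 4 * d
        rw [H.comb_comb]
        simp
        ring
      · change k3Form (_ + _ + _) (_ + _ + _) = 0
        rw [H.comb_comb]
        simp
    · fin_cases i
      · change k3Form (_ + _ + _) (a j) = 0
        rw [H.comb_a]
        ring
      · change k3Form (_ + _ + _) (a j) = 0
        rw [H.comb_a]
        simp
    · exact (k3Form_comm _ _).trans (hτS j _ (hvS (Sum.inl i)))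
    · fin_cases j
      · refine (k3Form_comm _ _).trans ?_
        change k3Form (_ + _ + _) (a i) = 0
        rw [H.comb_a]
        ring
      · refine (k3Form_comm _ _).trans ?_
        change k3Form (_ + _ + _) (a i) = 0
        rw [H.comb_a]
        simp
    · change k3Form (a i) (a j) = _
      rw [H.aa]
      change _ = (-2 : ℤ) • (1 : Matrix (Fin m) (Fin m) ℤ) i j
      rw [Matrix.one_apply]
      split_ifs <;> simp
    · exact (k3Form_comm _ _).trans (hτS j _ (hvS (Sum.inr i)))
    · exact hτS i _ (hvS (Sum.inl j))
    · exact hτS i _ (hvS (Sum.inr j))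
    · exact hττ i j
  obtain ⟨t, ht⟩ := exists_det_gram_eq (κ := (Fin 2 ⊕ Fin m) ⊕ κ) (by simp; omega)
    (Sum.elim v τ)
  rw [hG, det_fromBlocks_zero₂₁, det_fromBlocks_zero₂₁, det_fin_two_of, det_smul, det_one,
    Fintype.card_fin] at ht
  refine ⟨t, ?_⟩
  simp only [Matrix.of_apply]
  generalize (Matrix.of fun i j => 64 * k3Form (l i) (l j) - k3Form (y i) (y j)).det = D at ht
  have h2 : (-2 : ℤ) ^ m = 2 ^ m ∨ (-2 : ℤ) ^ m = -2 ^ m := by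
    rcases Nat.even_or_odd m with hm | hm
    · exact Or.inl (hm.neg_pow 2)
    · exact Or.inr (hm.neg_pow 2)
  rcases h2 with h2 | h2 <;> rw [h2] at ht <;> rcases ht with ht | ht
  · right; linear_combination -ht
  · left; linear_combination -ht
  · left; linear_combination ht
  · right; linear_combination ht

-- Multiplying column j by c_j clears the 2-power common to the Gram matrix of the y_i. In the
-- applications c_j y_j / 8 lies in S, so y_i · y_j c_j is divisible by 64.
open Matrix in
theorem exists_det_scaled_eq_sq (H : IsFiberConfig n d S h k a) {κ : Type*} [Fintype κ]
    [DecidableEq κ] (hκ : m + 2 + Fintype.card κ = 22) (y : κ → K3Lattice) (hyS : ∀ i, y i ∈ S)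
    (hy : ∀ i, ∀ s ∈ S, 8 ∣ k3Form (y i) s) (N : Matrix κ κ ℤ) (c : κ → ℤ)
    (hN : ∀ i j, 64 * N i j = -k3Form (y i) (y j) * c j) :
    ∃ e : Matrix κ κ ℤ, eᵀ = e ∧ (∀ i, Even (e i i)) ∧ ∃ t : ℤ,
      16 * d ^ 2 * 2 ^ m * 64 ^ Fintype.card κ * (N + e * diagonal c).det =
        (∏ i, c i) * t ^ 2 ∨
      16 * d ^ 2 * 2 ^ m * 64 ^ Fintype.card κ * (N + e * diagonal c).det =
        -((∏ i, c i) * t ^ 2) := by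
  obtain ⟨e, hs, hd, t, ht⟩ := H.exists_det_eq_sq hκ y hyS hy
  refine ⟨e, hs, hd, t, ?_⟩
  have key : (64 : ℤ) • (N + e * diagonal c) =
      (Matrix.of fun i j => 64 * e i j - k3Form (y i) (y j)) * diagonal c := by
    ext i j
    simp only [Matrix.smul_apply, Matrix.add_apply, mul_diagonal, Matrix.of_apply, smul_eq_mul,
      mul_add, hN]
    ring
  have hdet := congrArg Matrix.det key
  rw [det_smul, det_mul, det_diagonal] at hdet
  rcases ht with ht | ht
  · left
    rw [mul_assoc, hdet, ← ht]
    ring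
  · right
    rw [mul_assoc, hdet, neg_mul_eq_mul_neg, ← ht]
    ring

/-- Dividing out c² leaves plus or minus a square, and modulo 8 that is one of 0, 1, 4, 7. -/
theorem not_mod_eight_of_sq {c N t : ℤ} (hc : c ≠ 0) (h : c ^ 2 * N = t ^ 2 ∨ c ^ 2 * N = -t ^ 2) :
    (N : ZMod 8) ≠ 3 ∧ (N : ZMod 8) ≠ 5 := by
  have hdvd : c ∣ t := by
    rw [← Int.pow_dvd_pow_iff two_ne_zero]
    rcases h with h | h
    · exact ⟨N, h.symm⟩
    · exact ⟨-N, by linarith⟩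
  obtain ⟨s, rfl⟩ := hdvd
  have hs : N = s ^ 2 ∨ N = -s ^ 2 := by
    have hc2 : c ^ 2 ≠ 0 := pow_ne_zero 2 hc
    rcases h with h | h
    · left; exact mul_left_cancel₀ hc2 (by linarith)
    · right; exact mul_left_cancel₀ hc2 (by linarith)
  have hz : ∀ s : ZMod 8, (s ^ 2 ≠ 3 ∧ s ^ 2 ≠ 5) ∧ (-s ^ 2 ≠ 3 ∧ -s ^ 2 ≠ 5) := by decide
  rcases hs with rfl | rfl
  · push_cast
    exact (hz _).1
  · push_cast
    exact (hz _).2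

/-- The criterion `IsFiberConfig.eight_dvd_form` for a codeword of weight `8`. -/
theorem eight_dvd_form_lift (H : IsFiberConfig n d S h k a) {ε : Fin m → ZMod 2} {w : K3Lattice}
    {r : ℤ} (hw : (2 : ℤ) • w = r • k + ∑ i, ((ε i).val : ℤ) • a i)
    (hε : ∑ i, (ε i).val = 8) (p q : ℤ) (c : Fin m → ℤ)
    (h8 : 8 ∣ d * p * r + 4 * d * p - ∑ i, ((ε i).val : ℤ) * c i) :
    8 ∣ k3Form (p • h + q • k + ∑ i, c i • a i) w := by
  have h1 := congrArg (fun z => k3Form (p • h + q • k + ∑ i, c i • a i) z) hw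
  simp only [map_add (k3Form _), map_smul (k3Form _), map_sum (k3Form _), H.comb_k, H.comb_a,
    smul_eq_mul, mul_sub, Finset.sum_sub_distrib, ← Finset.sum_mul] at h1
  have hε' : ∑ i, ((ε i).val : ℤ) = 8 := by exact_mod_cast hε
  have h2 : ∑ i, ((ε i).val : ℤ) * (2 * c i) = 2 * ∑ i, ((ε i).val : ℤ) * c i := by
    rw [Finset.mul_sum]
    exact Finset.sum_congr rfl fun i _ => by ring
  rw [hε', h2] at h1
  convert h8 using 1
  linarith

/-- The integers r, s are the coefficients of k in twice the lifts of the words I, J. The lattice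
leaves them undetermined, so the dual vectors are written in terms of them. -/
theorem eight_dvd_form_twelve {a : Fin 12 → K3Lattice} (H : IsFiberConfig n d S h k a)
    (hd : 0 < d) (hdo : Odd d) (hI : IsWord S k a wordI) (hJ : IsWord S k a wordJ) :
    ∃ r s : ℤ, ∀ (p q : ℤ) (c : Fin 12 → ℤ), 8 ∣ 2 * n * p + 2 * d * q + d * ∑ i, c i →
      8 ∣ 2 * d * p → (∀ j, 8 ∣ d * p - 2 * c j) →
      8 ∣ d * p * r + 4 * d * p - ∑ i, ((wordI i).val : ℤ) * c i →
      8 ∣ d * p * s + 4 * d * p - ∑ i, ((wordJ i).val : ℤ) * c i →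
      ∀ x ∈ S, 8 ∣ k3Form (p • h + q • k + ∑ i, c i • a i) x := by
  obtain ⟨u, hu, huk, hua, r, hr⟩ := hI.exists_lift H (by norm_num) hd
  obtain ⟨v, hv, hvk, hva, s, hs⟩ := hJ.exists_lift H (by norm_num) hd
  refine ⟨r, s, fun p q c h1 h2 h3 h4 h5 => ?_⟩
  have hyu := H.eight_dvd_form_lift hr (by decide) p q c h4
  have hyv := H.eight_dvd_form_lift hs (by decide) p q c h5
  have hua' : ∀ i, (k3Form u (a i) : ZMod 2) = wordI i := fun i => by
    rw [hua]
    simp [CharTwo.neg_eq]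
  have hva' : ∀ i, (k3Form v (a i) : ZMod 2) = wordJ i := fun i => by
    rw [hva]
    simp [CharTwo.neg_eq]
  refine H.eight_dvd_form (by norm_num) hd hdo (H.not_isWord_one_twelve hd hI)
    (by rwa [H.comb_h]) (by rwa [H.comb_k]) (fun j => by rw [H.comb_a]; exact h3 j) ?_
  intro ζ hζ
  rcases IsWord.eq_twelve H hd hI hJ hζ with rfl | rfl | rfl | rfl
  · exact ⟨0, S.zero_mem, by simp, fun i => by simp, by simp⟩
  · exact ⟨u, hu, huk, hua', hyu⟩
  · exact ⟨v, hv, hvk, hva', hyv⟩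
  · exact ⟨u + v, S.add_mem hu hv, by simp [huk, hvk], fun i => by simp [hua', hva'],
      by rw [map_add (k3Form _)]; exact dvd_add hyu hyv⟩

theorem eight_dvd_form_eleven {a : Fin 11 → K3Lattice} (H : IsFiberConfig n d S h k a)
    (hd : 0 < d) (hdo : Odd d) (hK : IsWord S k a wordK) :
    ∃ r : ℤ, ∀ (p q : ℤ) (c : Fin 11 → ℤ), 8 ∣ 2 * n * p + 2 * d * q + d * ∑ i, c i →
      8 ∣ 2 * d * p → (∀ j, 8 ∣ d * p - 2 * c j) →
      8 ∣ d * p * r + 4 * d * p - ∑ i, ((wordK i).val : ℤ) * c i →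
      ∀ x ∈ S, 8 ∣ k3Form (p • h + q • k + ∑ i, c i • a i) x := by
  obtain ⟨u, hu, huk, hua, r, hr⟩ := hK.exists_lift H (by norm_num) hd
  refine ⟨r, fun p q c h1 h2 h3 h4 => ?_⟩
  have hyu := H.eight_dvd_form_lift hr (by decide) p q c h4
  refine H.eight_dvd_form (by norm_num) hd hdo (H.not_isWord_one_eleven hd)
    (by rwa [H.comb_h]) (by rwa [H.comb_k]) (fun j => by rw [H.comb_a]; exact h3 j) ?_
  intro ζ hζ
  rcases IsWord.eq_eleven H hd hK hζ with rfl | rfl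
  · exact ⟨0, S.zero_mem, by simp, fun i => by simp, by simp⟩
  · refine ⟨u, hu, huk, fun i => ?_, hyu⟩
    rw [hua]
    simp [CharTwo.neg_eq]

end IsFiberConfig

/-! ### Non-existence of the configurations -/

namespace IsFiberConfig

variable {n d : ℤ} {S : Submodule ℤ K3Lattice} {h k : K3Lattice}

/-- Coefficients at the vertices of `8` times vectors of the dual lattice, for `12` fibers. -/
def coeffTwelve (r s : ℤ) : BlockIndex (Fin 2) → Fin 12 → ℤ :=
  Sum.elim ![![4, -4, 0, 0, 0, 0, 0, 0, 0, 0, 0, 0],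
      ![0, 4, -4, 0, 0, 0, 0, 0, 0, 0, 0, 0]] <|
    Sum.elim ![![0, 0, 0, 0, 4, -4, 0, 0, 0, 0, 0, 0],
      ![0, 0, 0, 0, 0, 4, -4, 0, 0, 0, 0, 0]] <|
    Sum.elim ![![0, 0, 0, 0, 0, 0, 0, 0, 4, -4, 0, 0],
      ![0, 0, 0, 0, 0, 0, 0, 0, 0, 4, -4, 0]]
    ![![0, 0, 0, 4, 0, 0, 0, 4, 0, 0, 0, 4],
      ![2, 2, 2, 2 + 4 * s, 2, 2, 2, 2 + 4 * (r + s), 2, 2, 2, 2 + 4 * r]]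

/-- Coefficients at the vertices of `8` times vectors of the dual lattice, for `11` fibers. -/
def coeffEleven (r : ℤ) : BlockIndex (Fin 3) → Fin 11 → ℤ :=
  Sum.elim ![![4, -4, 0, 0, 0, 0, 0, 0, 0, 0, 0],
      ![0, 4, -4, 0, 0, 0, 0, 0, 0, 0, 0]] <|
    Sum.elim ![![0, 0, 0, 0, 4, -4, 0, 0, 0, 0, 0],
      ![0, 0, 0, 0, 0, 4, -4, 0, 0, 0, 0]] <|
    Sum.elim ![![0, 0, 0, 0, 0, 0, 0, 0, 4, -4, 0],
      ![0, 0, 0, 0, 0, 0, 0, 0, 0, 4, -4]]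
    ![![4, 4, 4, 4, 0, 0, 0, 0, 0, 0, 0],
      ![0, 0, 0, 4, 0, 0, 0, -4, 0, 0, 0],
      ![2, 2, 2, 2, 2, 2, 2, 2 - 4 * r, 2, 2, 2]]

/-- A family vanishing on the three blocks of size `2`. -/
def blockTail {ι : Type*} (p : ι → ℤ) : BlockIndex ι → ℤ :=
  Sum.elim 0 <| Sum.elim 0 <| Sum.elim 0 p

/-- The Gram matrix of the last block for `12` fibers. -/
def tailTwelve (n d r s : ℤ) : Matrix (Fin 2) (Fin 2) ℤ :=
  !![6, 3 + 4 * (r + s) - 4 * d; 3 + 4 * (r + s) - 4 * d,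
    6 - 12 * d + 4 * (r + s) - 2 * n + 2 * (s ^ 2 + (r + s) ^ 2 + r ^ 2) - 4 * d * (r + s)]

/-- The Gram matrix of the last block for `11` fibers. -/
def tailEleven (n d r : ℤ) : Matrix (Fin 3) (Fin 3) ℤ :=
  !![4, 1, 8 * (1 - d); 1, 2, 4 * r; 2 * (1 - d), r,
    11 - 4 * n - 24 * d - 4 * r + 4 * r ^ 2]

theorem gram_twelve {a : Fin 12 → K3Lattice} (H : IsFiberConfig n d S h k a) (r s : ℤ)
    (i j : BlockIndex (Fin 2)) :
    64 * blockGram (tailTwelve n d r s) i j =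
      -k3Form (blockTail ![0, 4] i • h + blockTail ![2, 0] i • k +
          ∑ l, coeffTwelve r s i l • a l)
        (blockTail ![0, 4] j • h + blockTail ![2, 0] j • k + ∑ l, coeffTwelve r s j l • a l) *
        blockScale (fun _ => 4) j := by
  rw [H.comb_comb, sum_fin_twelve, sum_fin_twelve, sum_fin_twelve]
  rcases i with i | i | i | i <;> rcases j with j | j | j | j <;> fin_cases i <;> fin_cases j <;>
    simp [blockGram, blockTail, coeffTwelve, blockScale, tailTwelve]
  all_goals ring

theorem gram_eleven {a : Fin 11 → K3Lattice} (H : IsFiberConfig n d S h k a) (r : ℤ)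
    (i j : BlockIndex (Fin 3)) :
    64 * blockGram (tailEleven n d r) i j =
      -k3Form (blockTail ![0, 0, 4] i • h + blockTail ![0, 0, 1 + 2 * r] i • k +
          ∑ l, coeffEleven r i l • a l)
        (blockTail ![0, 0, 4] j • h + blockTail ![0, 0, 1 + 2 * r] j • k +
          ∑ l, coeffEleven r j l • a l) *
        blockScale ![2, 2, 8] j := by
  rw [H.comb_comb, sum_fin_eleven, sum_fin_eleven, sum_fin_eleven]
  rcases i with i | i | i | i <;> rcases j with j | j | j | j <;> fin_cases i <;> fin_cases j <;>
    simp [blockGram, blockTail, coeffEleven, blockScale, tailEleven]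
  all_goals ring

theorem not_twelve {a : Fin 12 → K3Lattice} (hd : 0 < d) (hdo : Odd d) (hno : Odd n) :
    ¬ IsFiberConfig n d S h k a := by
  intro H₀
  obtain ⟨σ, hI, hJ⟩ := H₀.exists_perm_wordI_wordJ hd
  have H := H₀.comp_perm σ
  obtain ⟨r, s, hrs⟩ := H.eight_dvd_form_twelve hd hdo hI hJ
  obtain ⟨d', hd'⟩ := hdo
  obtain ⟨n', hn'⟩ := hno
  have hvI : ∀ i, ((wordI i).val : ℤ) = (![1, 1, 1, 1, 1, 1, 1, 1, 0, 0, 0, 0] : Fin 12 → ℤ) i := by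
    decide
  have hvJ : ∀ i, ((wordJ i).val : ℤ) = (![0, 0, 0, 0, 1, 1, 1, 1, 1, 1, 1, 1] : Fin 12 → ℤ) i := by
    decide
  -- Six vectors are 4 times differences of vertices inside the blocks of the code. The other two
  -- divided by 8 are k/4 + (a₃ + a₇ + a₁₁)/2 and h/2 + Σ a_i/4 plus halves of a₃, a₇, a₁₁. The
  -- multiples s, r + s, r of these halves make the pairings with the lifts of I and J integral:
  -- index 3 lies only in I, 11 only in J, 7 in both.
  obtain ⟨e, hs, he, t, ht⟩ := H.exists_det_scaled_eq_sq (κ := BlockIndex (Fin 2)) (by simp)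
    (fun i => blockTail ![0, 4] i • h + blockTail ![2, 0] i • k +
      ∑ l, coeffTwelve r s i l • (a ∘ σ) l) (fun i => H.comb_mem _ _ _)
    (fun i => by
      refine hrs _ _ _ ?_ ?_ (fun j => ?_) ?_ ?_
      · rw [sum_fin_twelve]
        rcases i with i | i | i | i <;> fin_cases i <;> simp [blockTail, coeffTwelve]
        · omega
        · exact ⟨n + 3 * d + d * (r + s), by ring⟩
      · rcases i with i | i | i | i <;> fin_cases i <;> simp [blockTail]
        omega
      · rcases i with i | i | i | i <;> fin_cases i <;> fin_cases j <;>
          simp [blockTail, coeffTwelve]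
        all_goals omega
      · simp only [hvI]
        rw [sum_fin_twelve]
        rcases i with i | i | i | i <;> fin_cases i <;> simp [blockTail, coeffTwelve]
        exact ⟨d' * r + 4 * d' - s, by rw [hd']; ring⟩
      · simp only [hvJ]
        rw [sum_fin_twelve]
        rcases i with i | i | i | i <;> fin_cases i <;> simp [blockTail, coeffTwelve]
        exact ⟨d' * s + 4 * d' - r, by rw [hd']; ring⟩)
    _ _ (H.gram_twelve r s)
  have hdet := det_blockGram_two (tailTwelve n d r s) e hs he rfl
    -- The oddness of n enters through the last diagonal entry, where 6 - 2n must be divisible by 4.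
    ⟨1 + 2 * (r + s) - 2 * d, by simp [tailTwelve]; ring⟩ rfl
    ⟨1 - 3 * d + (r + s) - n' + (s ^ 2 + r * s + r ^ 2) - d * (r + s), by
      simp [tailTwelve, hn']; ring⟩
  -- The factor 16 · 2^12 · 64^8 = 2^64 divided by the product 2^10 of the scales is (2^27)².
  refine (not_mod_eight_of_sq (c := d * 2 ^ 27) (by positivity) (t := t) ?_).2 hdet
  have hprod : ∏ i, blockScale (fun _ : Fin 2 => (4 : ℤ)) i = 2 ^ 10 := by decide
  rw [hprod] at ht
  simp only [Fintype.card_sum, Fintype.card_fin] at ht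
  have h2 : (2 : ℤ) ^ 10 ≠ 0 := by norm_num
  rcases ht with ht | ht
  · left; exact mul_left_cancel₀ h2 (by linear_combination ht)
  · right; exact mul_left_cancel₀ h2 (by linear_combination ht)

theorem not_eleven {a : Fin 11 → K3Lattice} (hd : 0 < d) (hdo : Odd d) (hno : Odd n) :
    ¬ IsFiberConfig n d S h k a := by
  intro H₀
  obtain ⟨σ, hK⟩ := H₀.exists_perm_wordK hd
  have H := H₀.comp_perm σ
  obtain ⟨r, hr⟩ := H.eight_dvd_form_eleven hd hdo hK
  obtain ⟨d', hd'⟩ := hdo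
  obtain ⟨n', hn'⟩ := hno
  have hvK : ∀ i, ((wordK i).val : ℤ) = (![1, 1, 1, 1, 1, 1, 1, 1, 0, 0, 0] : Fin 11 → ℤ) i := by
    decide
  -- The last vector has order dividing 8 modulo S, whence the scale 8. In it, 2 - 4r at the vertex
  -- of index 7 makes the pairing with the lift of K divisible by 8, and 1 + 2r at k then repairs
  -- the pairing with h.
  obtain ⟨e, hs, he, t, ht⟩ := H.exists_det_scaled_eq_sq (κ := BlockIndex (Fin 3)) (by simp)
    (fun i => blockTail ![0, 0, 4] i • h + blockTail ![0, 0, 1 + 2 * r] i • k +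
      ∑ l, coeffEleven r i l • (a ∘ σ) l) (fun i => H.comb_mem _ _ _)
    (fun i => by
      refine hr _ _ _ ?_ ?_ (fun j => ?_) ?_
      · rw [sum_fin_eleven]
        rcases i with i | i | i | i <;> fin_cases i <;> simp [blockTail, coeffEleven]
        · omega
        · exact ⟨n + 3 * d, by ring⟩
      · rcases i with i | i | i | i <;> fin_cases i <;> simp [blockTail]
        omega
      · rcases i with i | i | i | i <;> fin_cases i <;> fin_cases j <;>
          simp [blockTail, coeffEleven]
        all_goals omega
      · simp only [hvK]
        rw [sum_fin_eleven]
        rcases i with i | i | i | i <;> fin_cases i <;> simp [blockTail, coeffEleven]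
        exact ⟨d' * r + r + 4 * d', by rw [hd']; ring⟩)
    _ _ (H.gram_eleven r)
  -- Since 4r² - 4r vanishes modulo 8, the last diagonal entry is 11 - 4n, which is 7 for odd n.
  have hdet := det_blockGram_three (tailEleven n d r) e hs he rfl rfl rfl rfl
    ⟨1 - d, rfl⟩ ⟨r, rfl⟩ ⟨1 - d, rfl⟩ (by
      have h8 : (8 : ZMod 8) = 0 := rfl
      have hr2 : ∀ r : ZMod 8, 4 * r ^ 2 = 4 * r := by decide
      simp [tailEleven, hn', hr2]
      linear_combination (-n' - 3 * d : ZMod 8) * h8)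
  -- Here 16 · 2^11 · 64^9 = 2^69 and the scales multiply to 2^11, leaving (2^29)².
  refine (not_mod_eight_of_sq (c := d * 2 ^ 29) (by positivity) (t := t) ?_).1 hdet
  have hprod : ∏ i, blockScale (![2, 2, 8] : Fin 3 → ℤ) i = 2 ^ 11 := by decide
  rw [hprod] at ht
  simp only [Fintype.card_sum, Fintype.card_fin] at ht
  have h2 : (2 : ℤ) ^ 11 ≠ 0 := by norm_num
  rcases ht with ht | ht
  · left; exact mul_left_cancel₀ h2 (by linear_combination ht)
  · right; exact mul_left_cancel₀ h2 (by linear_combination ht)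

end IsFiberConfig

/-! ### The configuration of a subgeometric graph -/

namespace LoopFreeMultigraph

variable {V : Type*} [Fintype V] [DecidableEq V] (Γ : LoopFreeMultigraph V)

theorem fanoForm_fanoVec (n d : ℕ) (i j : Option V) :
    Γ.fanoForm n d (Γ.fanoVec n d i) (Γ.fanoVec n d j) = Γ.gram n d i j := by
  change Γ.preForm n d (Pi.single i 1) (Pi.single j 1) = _
  rw [preForm, Matrix.toBilin'_single]

theorem fanoVec_sum (n d : ℕ) (g : Option V → ℚ) :
    (Submodule.Quotient.mk g : Γ.FanoSpace n d) = ∑ i, g i • Γ.fanoVec n d i := by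
  conv_lhs => rw [pi_eq_sum_univ' g]
  rw [← Submodule.mkQ_apply, map_sum]
  refine Finset.sum_congr rfl fun i _ => ?_
  rw [map_smul]
  congr 2

end LoopFreeMultigraph

open LoopFreeMultigraph

/-- The sum of the two vertices of a fiber is orthogonal to all vertices and has degree 2d, for
every fiber; so two such sums differ by an element of the radical. -/
theorem fanoVec_add_fanoVec (m n d : ℕ) (i j : Fin m) :
    (affineA1.copies m).fanoVec n d (some (i, 0)) + (affineA1.copies m).fanoVec n d (some (i, 1)) =
      (affineA1.copies m).fanoVec n d (some (j, 0)) +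
        (affineA1.copies m).fanoVec n d (some (j, 1)) := by
  refine (Submodule.Quotient.eq _).2 ?_
  rw [LinearMap.mem_ker]
  refine LinearMap.pi_ext' fun l => LinearMap.ext_ring ?_
  have h0 : ∀ i : Fin m, (affineA1.copies m).preForm n d
      (Pi.single (some (i, 0)) 1 + Pi.single (some (i, 1)) 1) (Pi.single l 1) =
        if l = none then 2 * d else 0 := by
    intro i
    rw [map_add, LinearMap.add_apply, preForm, Matrix.toBilin'_single, Matrix.toBilin'_single]
    rcases l with _ | ⟨j, x⟩
    · simp [gram]
      ring
    · by_cases hij : i = j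
      · subst hij
        fin_cases x <;> simp [gram, copies, affineA1]
      · simp [gram, copies, hij]
  change (affineA1.copies m).preForm n d _ (Pi.single l 1) = 0
  rw [map_sub, LinearMap.sub_apply, h0, h0, sub_self]

theorem exists_integer_combination (m n d : ℕ) (i₀ : Fin m)
    (x : (affineA1.copies m).FanoSpace n d) :
    ∃ N : ℤ, N ≠ 0 ∧ ∃ (p q : ℤ) (c : Fin m → ℤ),
      N • x = p • (affineA1.copies m).fanoVec n d none +
        q • ((affineA1.copies m).fanoVec n d (some (i₀, 0)) +
          (affineA1.copies m).fanoVec n d (some (i₀, 1))) +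
        ∑ i, c i • (affineA1.copies m).fanoVec n d (some (i, 0)) := by
  obtain ⟨g, rfl⟩ := Submodule.Quotient.mk_surjective _ x
  obtain ⟨b, hb⟩ := IsLocalization.exist_integer_multiples_of_finite (nonZeroDivisors ℤ) g
  choose G hG using hb
  refine ⟨b, nonZeroDivisors.ne_zero b.2, G none, ∑ i, G (some (i, 1)),
    fun i => G (some (i, 0)) - G (some (i, 1)), ?_⟩
  have hG' : ∀ i, (b : ℤ) • g i • (affineA1.copies m).fanoVec n d i =
      G i • (affineA1.copies m).fanoVec n d i := fun i => by
    have h1 : ((G i : ℤ) : ℚ) = (b : ℤ) * g i := by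
      have := hG i
      simpa [Submonoid.smul_def] using this
    rw [← Int.cast_smul_eq_zsmul ℚ (b : ℤ), smul_smul, ← h1, Int.cast_smul_eq_zsmul]
  have hk : ∀ i, (affineA1.copies m).fanoVec n d (some (i, 1)) =
      ((affineA1.copies m).fanoVec n d (some (i₀, 0)) +
        (affineA1.copies m).fanoVec n d (some (i₀, 1))) -
          (affineA1.copies m).fanoVec n d (some (i, 0)) := fun i => by
    rw [fanoVec_add_fanoVec m n d i₀ i]
    abel
  rw [fanoVec_sum, Finset.smul_sum]
  simp only [hG']
  rw [Fintype.sum_option, Fintype.sum_prod_type, add_assoc]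
  congr 1
  rw [Finset.sum_smul, ← Finset.sum_add_distrib]
  refine Finset.sum_congr rfl fun i _ => ?_
  rw [Fin.sum_univ_two, hk i, smul_sub, sub_smul]
  abel

/-- The images of the fibers in the `K3`-lattice. -/
theorem exists_isFiberConfig (m n d : ℕ) (i₀ : Fin m)
    (hΓ : (affineA1.copies m).IsSubgeometric n d) :
    ∃ (S : Submodule ℤ K3Lattice) (h k : K3Lattice) (a : Fin m → K3Lattice),
      IsFiberConfig (n : ℤ) (d : ℤ) S h k a := by
  obtain ⟨-, K, -, ⟨⟨⟨hpol, hexc, -⟩, f, hfinj, hfiso, hfprim⟩, hsub, hroot⟩⟩ := hΓ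
  generalize latticeExtension _ _ K = M at *
  have hv : ∀ v, (affineA1.copies m).fanoVec n d (some v) ∈ M := fun v => (hsub ⟨v, rfl⟩).1
  have hform : ∀ i j (hi : (affineA1.copies m).fanoVec n d i ∈ M)
      (hj : (affineA1.copies m).fanoVec n d j ∈ M),
      ((k3Form (f ⟨_, hi⟩) (f ⟨_, hj⟩) : ℤ) : ℚ) = (affineA1.copies m).gram n d i j :=
    fun i j hi hj => by rw [hfiso]; exact fanoForm_fanoVec _ n d i j
  let h : K3Lattice := f ⟨_, hpol.mem⟩
  let u : Fin m × Fin 2 → K3Lattice := fun v => f ⟨_, hv v⟩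
  have hhh : k3Form h h = 2 * n := by
    have := hform none none hpol.mem hpol.mem
    rw [show (affineA1.copies m).gram n d none none = ((2 * n : ℤ) : ℚ) by simp [gram]] at this
    exact_mod_cast this
  have hhu : ∀ v, k3Form h (u v) = d := fun v => by
    have := hform none (some v) hpol.mem (hv v)
    rw [show (affineA1.copies m).gram n d none (some v) = ((d : ℤ) : ℚ) by simp [gram]] at this
    exact_mod_cast this
  have huh : ∀ v, k3Form (u v) h = d := fun v => by rw [k3Form_comm, hhu]
  have huu : ∀ i j x y, k3Form (u (i, x)) (u (j, y)) =
      if i = j then (if x = y then -2 else 2) else 0 := fun i j x y => by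
    have := hform (some (i, x)) (some (j, y)) (hv _) (hv _)
    have h2 : (affineA1.copies m).gram n d (some (i, x)) (some (j, y)) =
        ((if i = j then (if x = y then -2 else 2) else 0 : ℤ) : ℚ) := by
      by_cases hij : i = j <;> by_cases hxy : x = y <;>
        simp [gram, copies, affineA1, hij, hxy]
    rw [h2] at this
    exact_mod_cast this
  refine ⟨LinearMap.range f, h, u (i₀, 0) + u (i₀, 1), fun i => u (i, 0), ?_⟩
  refine
    { primitive := hfprim
      h_mem := LinearMap.mem_range_self _ _
      k_mem := Submodule.add_mem _ (LinearMap.mem_range_self _ _) (LinearMap.mem_range_self _ _)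
      a_mem := fun i => LinearMap.mem_range_self _ _
      hh := hhh
      hk := by rw [map_add, hhu, hhu]; ring
      kk := by simp [huu]
      ka := fun i => by by_cases hi : i₀ = i <;> simp [huu, hi]
      aa := fun i j => by simp [huu]
      ha := fun i => hhu _
      gen := ?_
      no_root := ?_ }
  · rintro _ ⟨s, rfl⟩
    obtain ⟨N, hN, p, q, c, hc⟩ := exists_integer_combination m n d i₀ s.1
    refine ⟨N, hN, p, q, c, ?_⟩
    have hs : N • s = p • (⟨_, hpol.mem⟩ : M) +
        q • ((⟨_, hv (i₀, 0)⟩ : M) + ⟨_, hv (i₀, 1)⟩) + ∑ i, c i • (⟨_, hv (i, 0)⟩ : M) := by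
      apply Subtype.ext
      simpa using hc
    rw [← map_smul, hs]
    simp only [map_add, map_smul, map_sum, h, u]
  · rintro _ ⟨e, rfl⟩ he2 he0 hed i
    by_contra! hneg
    have he2' : (affineA1.copies m).fanoForm n d e e = -2 := by
      rw [← hfiso, he2]
      norm_num
    have heh : ((k3Form (f e) h : ℤ) : ℚ) = (affineA1.copies m).fanoForm n d e
        ((affineA1.copies m).fanoVec n d none) := hfiso e ⟨_, hpol.mem⟩
    have hev : ((k3Form (f e) (u (i, 0)) : ℤ) : ℚ) = (affineA1.copies m).fanoForm n d e
        ((affineA1.copies m).fanoVec n d (some (i, 0))) := hfiso e ⟨_, hv _⟩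
    obtain ⟨r, hr⟩ := Int.eq_ofNat_of_zero_le he0
    rw [hr] at heh hed
    -- Degree 0 is excluded by the absence of exceptional divisors, positive degrees below d by the
    -- condition on inadmissible roots; `no_root` merges both.
    rcases Nat.eq_zero_or_pos r with rfl | hr0
    · exact hexc ⟨e, e.2, he2', by rw [← heh]; norm_num⟩
    · refine hroot r hr0 (by exact_mod_cast hed) ⟨e, ⟨e.2, he2', by rw [← heh]; norm_cast⟩,
        _, ⟨(i, 0), rfl⟩, ?_⟩
      rw [← hev]
      exact_mod_cast hneg

theorem mainTheorem8 (d : ℕ) (hd : Odd d) (hd1 : 1 < d) :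
    ∃ N : ℕ, ∀ n : ℕ, Odd n → N ≤ n →
      ¬ (affineA1.copies 12).IsSubgeometric n d ∧
      ¬ (affineA1.copies 11).IsSubgeometric n d := by
  -- The obstruction is a congruence modulo 8, so the threshold can be 0.
  refine ⟨0, fun n hn _ => ⟨fun hΓ => ?_, fun hΓ => ?_⟩⟩
  · obtain ⟨S, h, k, a, H⟩ := exists_isFiberConfig 12 n d 0 hΓ
    exact IsFiberConfig.not_twelve (by omega) (by exact_mod_cast hd) (by exact_mod_cast hn) H
  · obtain ⟨S, h, k, a, H⟩ := exists_isFiberConfig 11 n d 0 hΓ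
    exact IsFiberConfig.not_eleven (by omega) (by exact_mod_cast hd) (by exact_mod_cast hn) H
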